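/- Let $k$ be a field, let $h\ge 1$ be an integer and let $h\ge d_1\ge d_2\ge d_3\ge 0$ be integers. **Polygons.** For integers $c_1,\dots,c_N$ between $0$ and $h$ let $P(c_1,\dots,c_N):[0,h]\to\mathbb R$ be the function $$P(c_1,\dots,c_N)(x)=\frac1N\sum_{i=1}^N\max(0,\,x+c_i-h).$$ Let $\mathcal P_N$ be the set of convex polygons on $[0,h]$ starting at $(0,0)$, whose breakpoints have integral $x$-coordinates and whose slopes lie in $\frac1N\mathbb Z\cap[0,1]$; every element of $\mathcal P_N$ is of the form $P(c_1,\dots,c_N)$ for unique $h\ge c_1\ge\dots\ge c_N\ge 0$. Write $P\ge Q$ if $P(x)\ge Q(x)$ for all $x\in[0,h]$. For $P\in\mathcal P_{N_1}$, $Q\in\mathcal P_{N_2}$ put $P\star Q=\frac{1}{N_1+N_2}(N_1P+N_2Q)\in\mathcal P_{N_1+N_2}$. **Hodge polygons.** Let $e\ge1$ and let $M$ be a finite-dimensional $k$-vector space with a structure of $k[T]/T^e$-module generated by at most $h$ elements. Then $M\simeq\bigoplus_{i=1}^h k[T]/T^{a_i}$ with $0\le a_1\le\dots\le a_h\le e$,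 and $\mathrm{Hdg}(M)\in\mathcal P_e$ is the convex polygon starting at $(0,0)$ with slopes $a_1/e,\dots,a_h/e$. **The set $X$.** Let $X$ be the set of isomorphism classes of finite-dimensional $k[T]/T^3$-modules $M$, generated by at most $h$ elements, equipped with a PR datum of type $(d_1,d_2,d_3)$, that is, $k$-subspaces $0=M_0\subseteq M_1\subseteq M_2\subseteq M_3=M$ with $T\cdot M_i\subseteq M_{i-1}$ and $\dim_k M_i/M_{i-1}=d_i$ for $1\le i\le 3$; isomorphisms are the $k[T]/T^3$-linear isomorphisms matching the filtrations. Note that $M_2$ and $M/M_1$ are $k[T]/T^2$-modules. **The set $Y^{adm}$.** Let $Y$ be the set of triples $(P_1,P_2,P_3)$ with * $P_1\in\mathcal P_3$ and $P_2,P_3\in\mathcal P_2$; * $P_1(h)=\frac{d_1+d_2+d_3}{3}$, $P_2(h)=\frac{d_1+d_2}{2}$, $P_3(h)=\frac{d_2+d_3}{2}$; * $P_1\ge P_2\star P(d_3)$ and $P_1\ge P_3\star P(d_1)$; * $P_2\ge P(d_1,d_2)$ and $P_3\ge P(d_2,d_3)$. Let $Y^{adm}\subseteq Y$ be the subset of those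 triples such that, writing $P_1=P(\delta_1,\delta_2,\delta_3)$, $P_2=P(\alpha_1,\alpha_2)$, $P_3=P(\beta_1,\beta_2)$ with integers $h\ge\delta_1\ge\delta_2\ge\delta_3\ge0$, $h\ge\alpha_1\ge\alpha_2\ge0$, $h\ge\beta_1\ge\beta_2\ge0$, one has $$\delta_1+\max(d_2,\delta_2)\le\alpha_1+\beta_1.$$ **Theorem.** The map $$\phi:\ (0\subseteq M_1\subseteq M_2\subseteq M)\longmapsto(\mathrm{Hdg}(M),\ \mathrm{Hdg}(M_2),\ \mathrm{Hdg}(M/M_1))$$ is well defined on $X$ and is a bijection from $X$ onto $Y^{adm}$. -/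

import Mathlib

open Polynomial

universe u

noncomputable section

/-! ### Polygons on `[0, h]` -/

/-- Real-valued functions on `[0, h]`; the order `P₂ ≤ P₁` is the pointwise one
("`P₁` lies above `P₂`"). -/
abbrev HPolygon (h : ℕ) : Type := Set.Icc (0 : ℝ) (h : ℝ) → ℝ

/-- The value at the left end point `0`. -/
def HPolygon.left {h : ℕ} (P : HPolygon h) : ℝ := P ⟨0, le_rfl, Nat.cast_nonneg h⟩

/-- The value at the right end point `h`. -/
def HPolygon.right {h : ℕ} (P : HPolygon h) : ℝ := P ⟨h, Nat.cast_nonneg h, le_rfl⟩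

/-- `P(d_1, …, d_N)(x) = (1/N) ∑ max(0, x + d_i - h)`. -/
def polygonOf (h : ℕ) {N : ℕ} (d : Fin N → ℕ) : HPolygon h :=
  fun x => (1 / (N : ℝ)) * ∑ i, max 0 ((x : ℝ) + d i - h)

/-- The set `𝒫_N` of convex polygons on `[0, h]` starting at the origin, with breakpoints at
integers and slopes in `(1/N) ℤ ∩ [0, 1]`. -/
def polygonSet (h N : ℕ) : Set (HPolygon h) :=
  {P | P.left = 0 ∧
    ConvexOn ℝ (Set.Icc (0 : ℝ) h) (Set.IccExtend (Nat.cast_nonneg h) P) ∧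
    ∀ i : ℕ, i < h → ∃ m : ℕ, m ≤ N ∧ ∀ x y : Set.Icc (0 : ℝ) (h : ℝ),
      (i : ℝ) ≤ x → (x : ℝ) ≤ y → (y : ℝ) ≤ i + 1 →
        P y - P x = ((m : ℝ) / N) * ((y : ℝ) - x)}

/-- `P₁ ⋆ P₂ = (N₁ P₁ + N₂ P₂) / (N₁ + N₂)` for `P₁ ∈ 𝒫_{N₁}` and `P₂ ∈ 𝒫_{N₂}`. -/
def HPolygon.star {h : ℕ} (N₁ N₂ : ℕ) (P₁ P₂ : HPolygon h) : HPolygon h :=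
  fun x => (1 / ((N₁ : ℝ) + N₂)) * (N₁ * P₁ x + N₂ * P₂ x)

/-- The polygon starting at the origin whose slope on `[i, i + 1]` is `s i`. -/
def polygonOfSlopes {h : ℕ} (s : Fin h → ℝ) : HPolygon h :=
  fun x => ∑ i : Fin h, s i * max 0 (min 1 ((x : ℝ) - (i : ℕ)))

/-! ### The Hodge polygon -/

/-- `(V, T)` is isomorphic to `⨁_{i=1}^h k[T]/T^{a_i}` with `0 ≤ a_1 ≤ … ≤ a_h ≤ e`. -/
def IsHodgeType {k : Type u} [Field k] {V : Type u} [AddCommGroup V] [Module k V]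
    (h e : ℕ) (T : Module.End k V) (a : Fin h → ℕ) : Prop :=
  Monotone a ∧ (∀ i, a i ≤ e) ∧
    ∃ f : V ≃ₗ[k] ((i : Fin h) → k[X] ⧸ Ideal.span {(X : k[X]) ^ a i}),
      ∀ v, f (T v) = (X : k[X]) • f v

open scoped Classical in
/-- The Hodge polygon of `(V, T)`, seen as a module over `k[T]/T^e` generated by at most `h`
elements: the convex polygon with slopes `a_1/e, …, a_h/e`, where
`V ≅ ⨁_{i=1}^h k[T]/T^{a_i}`. Such a sequence `a` exists (and is unique) as soon as `T^e = 0` and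
`V` is generated by at most `h` elements; the value `0` is a default in the other cases. -/
def hodgePolygon {k : Type u} [Field k] {V : Type u} [AddCommGroup V] [Module k V]
    (h e : ℕ) (T : Module.End k V) : HPolygon h :=
  if H : ∃ a : Fin h → ℕ, IsHodgeType h e T a then
    polygonOfSlopes (fun i => (H.choose i : ℝ) / e)
  else 0

theorem IsHodgeType.of_equiv {k : Type u} [Field k] {V W : Type u} [AddCommGroup V] [Module k V]
    [AddCommGroup W] [Module k W] {h e : ℕ} {T : Module.End k V} {S : Module.End k W}
    (g : V ≃ₗ[k] W) (hg : ∀ v, g (T v) = S (g v)) {a : Fin h → ℕ}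
    (ha : IsHodgeType h e T a) : IsHodgeType h e S a := by
  obtain ⟨h1, h2, f, hf⟩ := ha
  refine ⟨h1, h2, g.symm.trans f, fun w => ?_⟩
  have : g.symm (S w) = T (g.symm w) := by
    rw [LinearEquiv.symm_apply_eq, hg, LinearEquiv.apply_symm_apply]
  simp only [LinearEquiv.trans_apply, this, hf]

theorem hodgePolygon_congr {k : Type u} [Field k] {V W : Type u} [AddCommGroup V] [Module k V]
    [AddCommGroup W] [Module k W] (h e : ℕ) {T : Module.End k V} {S : Module.End k W}
    (g : V ≃ₗ[k] W) (hg : ∀ v, g (T v) = S (g v)) :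
    hodgePolygon h e T = hodgePolygon h e S := by
  have key : (IsHodgeType h e T : (Fin h → ℕ) → Prop) = IsHodgeType h e S := by
    funext a
    refine propext ⟨IsHodgeType.of_equiv g hg, IsHodgeType.of_equiv g.symm fun w => ?_⟩
    rw [LinearEquiv.symm_apply_eq, hg, LinearEquiv.apply_symm_apply]
  unfold hodgePolygon
  rw [key]

/-! ### Modules over `k[T]/T^e` with a PR datum -/

/-- The ring `k[T]/T^e`. -/
abbrev TruncPoly (k : Type u) [Field k] (e : ℕ) : Type u :=
  k[X] ⧸ Ideal.span {(X : k[X]) ^ e}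

/-- Multiplication by `T` on a `k[T]/T^e`-module. -/
def mulT (k : Type u) [Field k] (e : ℕ) (M : Type u) [AddCommGroup M] [Module k M]
    [Module (TruncPoly k e) M] [IsScalarTower k (TruncPoly k e) M] : Module.End k M :=
  Algebra.lsmul k k M (Ideal.Quotient.mk (Ideal.span {(X : k[X]) ^ e}) X)

theorem mulT_apply (k : Type u) [Field k] (e : ℕ) (M : Type u) [AddCommGroup M] [Module k M]
    [Module (TruncPoly k e) M] [IsScalarTower k (TruncPoly k e) M] (x : M) :
    mulT k e M x = (Ideal.Quotient.mk (Ideal.span {(X : k[X]) ^ e}) X : TruncPoly k e) • x := rfl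

/-- A PR datum of type `(d_1, …, d_e)` on a `k[T]/T^e`-module `M`: vector subspaces
`0 = M_0 ⊆ M_1 ⊆ … ⊆ M_e = M` with `T M_i ⊆ M_{i-1}` and `dim M_i / M_{i-1} = d_i`.
Here `d_i` is `d (i-1)`. -/
structure PRDatum (k : Type u) [Field k] {e : ℕ} (d : Fin e → ℕ) (M : Type u) [AddCommGroup M]
    [Module k M] [Module (TruncPoly k e) M] [IsScalarTower k (TruncPoly k e) M] where
  /-- the filtration -/
  fil : Fin (e + 1) → Submodule k M
  fil_zero : fil 0 = ⊥
  fil_last : fil (Fin.last e) = ⊤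
  fil_mono : Monotone fil
  T_mem : ∀ (i : Fin e), ∀ x ∈ fil i.succ, mulT k e M x ∈ fil i.castSucc
  finrank_quot : ∀ i : Fin e,
    Module.finrank k (fil i.succ ⧸ (fil i.castSucc).submoduleOf (fil i.succ)) = d i

/-- A finite-dimensional `k[T]/T^e`-module generated by at most `h` elements, with a PR datum of
type `d`. The two scalar actions of `k` agree by `tower`. -/
structure PRModule (k : Type u) [Field k] (h : ℕ) {e : ℕ} (d : Fin e → ℕ) where
  /-- the underlying set -/
  carrier : Type u
  [group : AddCommGroup carrier]
  [moduleBase : Module k carrier]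
  [module : Module (TruncPoly k e) carrier]
  [tower : IsScalarTower k (TruncPoly k e) carrier]
  finite : Module.Finite k carrier
  generated : ∃ s : Finset carrier, s.card ≤ h ∧
    Submodule.span (TruncPoly k e) (s : Set carrier) = ⊤
  /-- the PR datum -/
  datum : PRDatum k d carrier

attribute [instance] PRModule.group PRModule.moduleBase PRModule.module PRModule.tower

namespace PRModule

variable {k : Type u} [Field k] {h e : ℕ} {d : Fin e → ℕ}

/-- Multiplication by `T`. -/
abbrev T (M : PRModule k h d) : Module.End k M.carrier := mulT k e M.carrier

/-- The `i`-th step of the filtration. -/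
abbrev fil (M : PRModule k h d) (i : Fin (e + 1)) : Submodule k M.carrier := M.datum.fil i

theorem T_stable (M : PRModule k h d) (i : Fin (e + 1)) :
    ∀ x ∈ M.fil i, M.T x ∈ M.fil i := by
  intro x hx
  induction i using Fin.cases with
  | zero =>
    have h0 := M.datum.fil_zero
    have : x = 0 := by simpa [h0] using hx
    subst this
    simp
  | succ i => exact M.datum.fil_mono (Fin.castSucc_lt_succ (i := i)).le (M.datum.T_mem i x hx)

/-- Multiplication by `T` on the step `M_i`. -/
def subT (M : PRModule k h d) (i : Fin (e + 1)) : Module.End k (M.fil i) :=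
  M.T.restrict (M.T_stable i)

/-- Multiplication by `T` on the quotient `M / M_i`. -/
def quotT (M : PRModule k h d) (i : Fin (e + 1)) : Module.End k (M.carrier ⧸ M.fil i) :=
  (M.fil i).mapQ (M.fil i) M.T (M.T_stable i)

/-- Isomorphism: a `k[T]/T^e`-linear bijection that matches the filtrations. -/
def Iso (M N : PRModule k h d) : Prop :=
  ∃ f : M.carrier ≃ₗ[TruncPoly k e] N.carrier, ∀ i x, x ∈ M.fil i ↔ f x ∈ N.fil i

instance isoSetoid (k : Type u) [Field k] (h : ℕ) {e : ℕ} (d : Fin e → ℕ) :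
    Setoid (PRModule k h d) where
  r := Iso
  iseqv :=
    { refl := fun _ => ⟨LinearEquiv.refl _ _, fun _ _ => Iff.rfl⟩
      symm := fun ⟨f, hf⟩ => ⟨f.symm, fun i x => by
        rw [hf i (f.symm x), LinearEquiv.apply_symm_apply]⟩
      trans := fun ⟨f, hf⟩ ⟨g, hg⟩ => ⟨f.trans g, fun i x => (hf i x).trans (hg i (f x))⟩ }

end PRModule

/-- The set of isomorphism classes of `k[T]/T^e`-modules (generated by at most `h` elements) with a
PR datum of type `d`. -/
def PRClass (k : Type u) [Field k] (h : ℕ) {e : ℕ} (d : Fin e → ℕ) : Type (u + 1) :=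
  Quotient (PRModule.isoSetoid k h d)

/-! ### The case `e = 3` -/

/-- `(Hdg(M), Hdg(M_2), Hdg(M / M_1))`, where `M_2` and `M / M_1` are seen as modules over
`k[T]/T^2`. -/
def hodgeTriple {k : Type u} [Field k] {h : ℕ} {d : Fin 3 → ℕ} (M : PRModule k h d) :
    HPolygon h × HPolygon h × HPolygon h :=
  (hodgePolygon h 3 M.T, hodgePolygon h 2 (M.subT 2), hodgePolygon h 2 (M.quotT 1))

theorem hodgeTriple_congr {k : Type u} [Field k] {h : ℕ} {d : Fin 3 → ℕ} (M N : PRModule k h d)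
    (H : M.Iso N) : hodgeTriple M = hodgeTriple N := by
  obtain ⟨f, hf⟩ := H
  let g : M.carrier ≃ₗ[k] N.carrier := f.restrictScalars k
  have hg : ∀ x, g (M.T x) = N.T (g x) := fun x => by
    simp only [PRModule.T, mulT_apply, g]
    exact f.map_smul _ x
  have hmap : ∀ i, (M.fil i).map (g : M.carrier →ₗ[k] N.carrier) = N.fil i := by
    intro i
    ext y
    constructor
    · rintro ⟨x, hx, rfl⟩
      exact (hf i x).1 hx
    · intro hy
      refine ⟨g.symm y, (hf i _).2 ?_, by simp⟩
      have : f (g.symm y) = y := g.apply_symm_apply y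
      rwa [this]
  have h1 : hodgePolygon h 3 M.T = hodgePolygon h 3 N.T := hodgePolygon_congr h 3 g hg
  have h2 : hodgePolygon h 2 (M.subT 2) = hodgePolygon h 2 (N.subT 2) :=
    hodgePolygon_congr h 2 (g.ofSubmodules _ _ (hmap 2)) fun v => Subtype.ext (hg v)
  have h3 : hodgePolygon h 2 (M.quotT 1) = hodgePolygon h 2 (N.quotT 1) := by
    refine hodgePolygon_congr h 2 (Submodule.Quotient.equiv _ _ g (hmap 1)) fun v => ?_
    induction v using Submodule.Quotient.induction_on with
    | _ x =>
      change Submodule.Quotient.mk (g (M.T x)) = Submodule.Quotient.mk (N.T (g x))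
      rw [hg]
  rw [hodgeTriple, hodgeTriple, h1, h2, h3]

/-- The map `φ` sending the class of `0 ⊆ M_1 ⊆ M_2 ⊆ M` to
`(Hdg(M), Hdg(M_2), Hdg(M / M_1))`. -/
def phi (k : Type u) [Field k] (h : ℕ) (d : Fin 3 → ℕ) :
    PRClass k h d → HPolygon h × HPolygon h × HPolygon h :=
  Quotient.lift hodgeTriple hodgeTriple_congr

/-- The set `Y` of triples of polygons. -/
def ySet (h d₁ d₂ d₃ : ℕ) : Set (HPolygon h × HPolygon h × HPolygon h) :=
  {P | (P.1 ∈ polygonSet h 3 ∧ P.2.1 ∈ polygonSet h 2 ∧ P.2.2 ∈ polygonSet h 2) ∧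
    (P.1.right = ((d₁ : ℝ) + d₂ + d₃) / 3 ∧ P.2.1.right = ((d₁ : ℝ) + d₂) / 2 ∧
      P.2.2.right = ((d₂ : ℝ) + d₃) / 2) ∧
    (HPolygon.star 2 1 P.2.1 (polygonOf h ![d₃]) ≤ P.1 ∧
      HPolygon.star 2 1 P.2.2 (polygonOf h ![d₁]) ≤ P.1) ∧
    (polygonOf h ![d₁, d₂] ≤ P.2.1 ∧ polygonOf h ![d₂, d₃] ≤ P.2.2)}

/-- The set `Y^adm` of admissible triples. The integers `δ_i`, `α_i`, `β_i` between `0` and `h` are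
uniquely determined by the polygons. -/
def yAdm (h d₁ d₂ d₃ : ℕ) : Set (HPolygon h × HPolygon h × HPolygon h) :=
  {P | P ∈ ySet h d₁ d₂ d₃ ∧ ∃ δ₁ δ₂ δ₃ α₁ α₂ β₁ β₂ : ℕ,
    (δ₃ ≤ δ₂ ∧ δ₂ ≤ δ₁ ∧ δ₁ ≤ h ∧ P.1 = polygonOf h ![δ₁, δ₂, δ₃]) ∧
    (α₂ ≤ α₁ ∧ α₁ ≤ h ∧ P.2.1 = polygonOf h ![α₁, α₂]) ∧
    (β₂ ≤ β₁ ∧ β₁ ≤ h ∧ P.2.2 = polygonOf h ![β₁, β₂]) ∧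
    δ₁ + max d₂ δ₂ ≤ α₁ + β₁}

end

/-! The classification is linear algebra followed by integer linear programming. Every module with a
PR datum splits into Jordan blocks whose vectors lie in prescribed steps of the filtration. Since
`T` lowers the step, a block amounts to a nonempty subset of {1, 2, 3} written in decreasing order.
There are seven types, so an isomorphism class is represented by multiplicities `n 0, …, n 6`
(`exists_blockVector`, `PRModule.exists_iso_blockModule`).

By `hodgePolygon_eq_polygonOf` a Hodge polygon only records the successive drops of the ranks of
powers of `T`. For a sum of blocks these drops count the blocks of length at least 1, 2, 3 in `M`,
in `M₂` (delete 3 from each block) and in `M / M₁` (delete 1). The type `d` fixes the right end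
points, so the free data are d₁, d₂, d₃, δ₂, δ₃, α₂, β₂: seven integers depending on the seven
multiplicities through an invertible integral linear system. This gives injectivity.

For the image, nonnegativity of the multiplicities must be matched with the polygon conditions. The
two `⋆`-inequalities give δ₁ ≥ α₁, β₁ and δ₃ ≤ α₂, β₂, which make n 2, n 0, n 3, n 5 nonnegative,
and n 6 = δ₃. Finally α₁ + β₁ = δ₁ + d₂ + n 4 = δ₁ + δ₂ + n 1, so admissibility is exactly n 4 ≥ 0
and n 1 ≥ 0. -/

noncomputable section

/-! ### Hodge polygons from ranks of powers -/

section Hodge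

variable {k : Type u} [Field k] {V : Type u} [AddCommGroup V] [Module k V]

theorem finrank_quotient_X_pow (m : ℕ) :
    Module.finrank k (k[X] ⧸ Ideal.span {(X : k[X]) ^ m}) = m := by
  rw [finrank_quotient_span_eq_natDegree, natDegree_X_pow]

instance finite_quotient_X_pow (m : ℕ) :
    Module.Finite k (k[X] ⧸ Ideal.span {(X : k[X]) ^ m}) :=
  (monic_X_pow m).finite_quotient

/-- The rank of `T ^ j` when `(V, T) ≅ ⨁ k[T]/T^{a_i}`. -/
theorem finrank_range_pow_of_equiv {ι : Type*} [Fintype ι] {a : ι → ℕ} {T : Module.End k V}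
    (f : V ≃ₗ[k] ((i : ι) → k[X] ⧸ Ideal.span {(X : k[X]) ^ a i}))
    (hf : ∀ v, f (T v) = (X : k[X]) • f v) (j : ℕ) :
    Module.finrank k (LinearMap.range (T ^ j)) = ∑ i, (a i - j) := by
  have hfj : ∀ v, f ((T ^ j) v) = (X : k[X]) ^ j • f v := by
    induction j with
    | zero => simp
    | succ j ih => intro v; rw [pow_succ', Module.End.mul_apply, hf, ih, smul_smul, pow_succ']
  let π : ∀ b : ι → ℕ, (ι → k[X]) →ₗ[k] ((i : ι) → k[X] ⧸ Ideal.span {(X : k[X]) ^ b i}) :=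
    fun b => LinearMap.pi fun i =>
      (Ideal.Quotient.mkₐ k (Ideal.span {(X : k[X]) ^ b i})).toLinearMap ∘ₗ LinearMap.proj i
  have hπ : ∀ b, Function.Surjective (π b) := by
    intro b w
    choose p hp using fun i => Ideal.Quotient.mk_surjective (w i)
    exact ⟨p, funext hp⟩
  let g : (ι → k[X]) →ₗ[k] V := (T ^ j) ∘ₗ f.symm.toLinearMap ∘ₗ π a
  have hg : LinearMap.range g = LinearMap.range (T ^ j) := by
    apply LinearMap.range_comp_of_range_eq_top
    rw [LinearMap.range_eq_top]
    exact f.symm.surjective.comp (hπ a)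
  -- Multiplication by X ^ j sends p into (X ^ a) exactly when X ^ (a - j) divides p, with truncated
  -- subtraction covering a ≤ j. So the range of T ^ j is again a sum of cyclic modules, with
  -- exponents a i - j.
  have hk : LinearMap.ker g = LinearMap.ker (π fun i => a i - j) := by
    ext p
    have h1 : g p = 0 ↔ ∀ i, (X : k[X]) ^ a i ∣ X ^ j * p i := by
      rw [← f.map_eq_zero_iff]
      change f ((T ^ j) (f.symm (π a p))) = 0 ↔ _
      rw [hfj, f.apply_symm_apply, funext_iff]
      refine forall_congr' fun i => ?_
      rw [← Ideal.mem_span_singleton, ← Ideal.Quotient.eq_zero_iff_mem]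
      rfl
    have h2 : π (fun i => a i - j) p = 0 ↔ ∀ i, (X : k[X]) ^ (a i - j) ∣ p i := by
      rw [funext_iff]
      refine forall_congr' fun i => ?_
      rw [← Ideal.mem_span_singleton, ← Ideal.Quotient.eq_zero_iff_mem]
      rfl
    rw [LinearMap.mem_ker, LinearMap.mem_ker, h1, h2]
    refine forall_congr' fun i => ?_
    rcases le_total (a i) j with hij | hij
    · simp only [Nat.sub_eq_zero_of_le hij, pow_zero, isUnit_one, IsUnit.dvd, iff_true]
      exact (pow_dvd_pow X hij).mul_right _
    · nth_rw 1 [← Nat.add_sub_of_le hij, pow_add]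
      exact mul_dvd_mul_iff_left (pow_ne_zero _ X_ne_zero)
  rw [← hg, (g.quotKerEquivRange.symm ≪≫ₗ Submodule.quotEquivOfEq _ _ hk ≪≫ₗ
    (π _).quotKerEquivOfSurjective (hπ _)).finrank_eq, Module.finrank_pi_fintype]
  simp [finrank_quotient_X_pow]

/-- Restriction of a family along an injection outside of whose range the modules vanish. -/
def piEquivOfInjective {R : Type*} [Semiring R] {ι κ : Type*} (φ : ι → κ)
    (hφ : Function.Injective φ) (W : κ → Type*) [∀ i, AddCommMonoid (W i)] [∀ i, Module R (W i)]
    (hW : ∀ j, j ∉ Set.range φ → Subsingleton (W j)) :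
    ((j : κ) → W j) ≃ₗ[R] ((i : ι) → W (φ i)) :=
  LinearEquiv.ofBijective (LinearMap.pi fun i => LinearMap.proj (φ i)) <| by
    classical
    constructor
    · intro v w hvw
      funext j
      by_cases hj : j ∈ Set.range φ
      · obtain ⟨i, rfl⟩ := hj
        exact congrFun hvw i
      · exact (hW j hj).elim _ _
    · intro v
      refine ⟨fun j => if hj : j ∈ Set.range φ then hj.choose_spec ▸ v hj.choose else 0, ?_⟩
      funext i
      have hi : φ i ∈ Set.range φ := ⟨i, rfl⟩
      change (if hj : φ i ∈ Set.range φ then _ else _) = _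
      rw [dif_pos hi]
      -- The chosen preimage equals `i` only propositionally; generalizing over it lets the
      -- transport be eliminated.
      have key : ∀ (i' : ι) (e : φ i' = φ i), (e ▸ v i' : W (φ i)) = v i := by
        intro i' e
        obtain rfl := hφ e
        rfl
      exact key _ _

/-- A nilpotent endomorphism of a finite-dimensional space is a direct sum of Jordan blocks. -/
theorem exists_equiv_pi_quotient_X_pow [Module.Finite k V] {e : ℕ} {T : Module.End k V}
    (hT : T ^ e = 0) : ∃ (m : ℕ) (a : Fin m → ℕ)
      (f : V ≃ₗ[k] ((i : Fin m) → k[X] ⧸ Ideal.span {(X : k[X]) ^ a i})),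
      ∀ v, f (T v) = (X : k[X]) • f v := by
  have : Module.Finite k[X] (Module.AEval' T) := by
    have : Module.Finite k (Module.AEval' T) := inferInstanceAs (Module.Finite k V)
    exact Module.Finite.of_restrictScalars_finite k _ _
  have htors : Module.IsTorsion' (Module.AEval' T) (Submonoid.powers (X : k[X])) := by
    intro x
    refine ⟨⟨X ^ e, e, rfl⟩, ?_⟩
    obtain ⟨v, rfl⟩ := (Module.AEval'.of T).surjective x
    change (X : k[X]) ^ e • Module.AEval'.of T v = 0
    rw [Module.AEval'.X_pow_smul_of, hT]
    simp
  obtain ⟨m, a, ⟨f⟩⟩ := Module.torsion_by_prime_power_decomposition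
    (irreducible_X (R := k)) htors
  let g := f.trans (DirectSum.linearEquivFunOnFintype k[X] (Fin m)
    fun i => k[X] ⧸ Ideal.span {(X : k[X]) ^ a i})
  refine ⟨m, a, (Module.AEval'.of T).trans (g.restrictScalars k), fun v => ?_⟩
  change g (Module.AEval'.of T (T v)) = X • g (Module.AEval'.of T v)
  rw [← map_smul, Module.AEval'.X_smul_of]

theorem exists_isHodgeType [Module.Finite k V] {h e : ℕ} {T : Module.End k V} (hT : T ^ e = 0)
    (hgen : Module.finrank k V ≤ Module.finrank k (LinearMap.range T) + h) :
    ∃ a : Fin h → ℕ, IsHodgeType h e T a := by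
  classical
  obtain ⟨m, a, f, hf⟩ := exists_equiv_pi_quotient_X_pow hT
  have hle : ∀ i, a i ≤ e := by
    have h1 := finrank_range_pow_of_equiv f hf e
    rw [hT, LinearMap.range_zero, finrank_bot, eq_comm, Finset.sum_eq_zero_iff] at h1
    intro i
    have := h1 i (Finset.mem_univ i)
    omega
  -- Each nonzero block contributes one to dim V - rank T, which is at most h.
  have hcard : Fintype.card {i // a i ≠ 0} ≤ Fintype.card (Fin h) := by
    have h0 := finrank_range_pow_of_equiv f hf 0
    have h1 := finrank_range_pow_of_equiv f hf 1
    rw [pow_zero, Module.End.one_eq_id, LinearMap.range_id, finrank_top] at h0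
    rw [pow_one] at h1
    have h2 : ∑ i, (a i - 0) = ∑ i, (a i - 1) + Fintype.card {i // a i ≠ 0} := by
      rw [Fintype.card_subtype, Finset.card_filter, ← Finset.sum_add_distrib]
      refine Finset.sum_congr rfl fun i _ => ?_
      split_ifs <;> omega
    rw [Fintype.card_fin]
    omega
  obtain ⟨ψ⟩ := Function.Embedding.nonempty_of_card_le hcard
  -- Unused indices receive exponent 0, that is, the zero module, so padding to length h and then
  -- sorting does not change the module.
  let b : Fin h → ℕ := Function.extend ψ (fun i => a i) 0
  have hb : ∀ i, b (ψ i) = a i := fun i => ψ.injective.extend_apply _ _ i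
  have hb0 : ∀ j, j ∉ Set.range ψ → b j = 0 := fun j hj => Function.extend_apply' _ _ j hj
  have hsub : ∀ m : ℕ, m = 0 → Subsingleton (k[X] ⧸ Ideal.span {(X : k[X]) ^ m}) := by
    rintro _ rfl
    rw [Ideal.Quotient.subsingleton_iff, pow_zero, Ideal.span_singleton_one]
  let Q : ℕ → Type u := fun m => k[X] ⧸ Ideal.span {(X : k[X]) ^ m}
  let σ := Tuple.sort b
  let e₁ : ((i : Fin m) → Q (a i)) ≃ₗ[k[X]] ((i : {i // a i ≠ 0}) → Q (a i)) :=
    piEquivOfInjective Subtype.val Subtype.val_injective (fun i => Q (a i)) fun j hj =>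
      hsub _ (by simpa using hj)
  let e₂ : ((i : Fin h) → Q (b i)) ≃ₗ[k[X]] ((i : {i // a i ≠ 0}) → Q (b (ψ i))) :=
    piEquivOfInjective ψ ψ.injective (fun i => Q (b i)) fun j hj => hsub _ (hb0 j hj)
  let e₃ : ((i : {i // a i ≠ 0}) → Q (b (ψ i))) ≃ₗ[k[X]] ((i : {i // a i ≠ 0}) → Q (a i)) :=
    LinearEquiv.piCongrRight fun i => Submodule.quotEquivOfEq _ _ (by rw [hb])
  let e₄ : ((i : Fin h) → Q (b i)) ≃ₗ[k[X]] ((i : Fin h) → Q (b (σ i))) :=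
    piEquivOfInjective σ σ.injective (fun i => Q (b i)) fun j hj => (hj (σ.surjective j)).elim
  let g := e₁.trans (e₃.symm.trans (e₂.symm.trans e₄))
  refine ⟨b ∘ σ, Tuple.monotone_sort b, fun i => ?_, f.trans (g.restrictScalars k), fun v => ?_⟩
  · by_cases hi : σ i ∈ Set.range ψ
    · obtain ⟨j, hj⟩ := hi
      rw [Function.comp_apply, ← hj, hb]
      exact hle _
    · rw [Function.comp_apply, hb0 _ hi]
      exact Nat.zero_le _
  · change g (f (T v)) = X • g (f v)
    rw [hf, map_smul]

/-- The sum of the clamped functions `x - i` for `i` in the last `c` unit intervals of `[0, h]`. -/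
theorem sum_clamp_eq_max {h c : ℕ} (hc : c ≤ h) {x : ℝ} (hx : x ≤ h) :
    ∑ i : Fin h, (if h - c ≤ (i : ℕ) then max 0 (min 1 (x - (i : ℕ))) else 0) =
      max 0 (x + c - h) := by
  rw [Fin.sum_univ_eq_sum_range (fun i : ℕ => if h - c ≤ i then max 0 (min 1 (x - i)) else 0) h]
  induction c with
  | zero =>
    rw [Finset.sum_eq_zero, max_eq_left (by push_cast; linarith)]
    intro i hi
    rw [if_neg (by have := Finset.mem_range.1 hi; omega)]
  | succ c ih =>
    -- Passing from c to c + 1 adds only the unit interval starting at h - (c + 1).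
    have hmem : h - (c + 1) ∈ Finset.range h := Finset.mem_range.2 (by omega)
    have hcast : ((h - (c + 1) : ℕ) : ℝ) = h - (c + 1) := by push_cast [hc]; ring
    rw [← Finset.add_sum_erase _ _ hmem, if_pos le_rfl]
    rw [← Finset.add_sum_erase _ _ hmem, if_neg (by omega), zero_add] at ih
    rw [Finset.sum_congr rfl (g := fun i : ℕ => if h - c ≤ i then max 0 (min 1 (x - i)) else 0),
      ih (by omega), hcast]
    · push_cast
      rcases max_cases 0 (x + c - h) with h1 | h1 <;>
      rcases max_cases 0 (x + (c + 1) - h) with h2 | h2 <;>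
      rcases min_cases 1 (x - (h - (c + 1))) with h3 | h3 <;>
      rcases max_cases 0 (min 1 (x - ((h : ℝ) - (c + 1)))) with h4 | h4 <;> linarith
    · intro i hi
      have := Finset.ne_of_mem_erase hi
      exact if_congr (by omega) rfl rfl

theorem polygonOfSlopes_eq_polygonOf {h e : ℕ} {a : Fin h → ℕ} (ha : Monotone a)
    (hae : ∀ i, a i ≤ e) :
    polygonOfSlopes (fun i => (a i : ℝ) / e) =
      polygonOf h fun j : Fin e => (Finset.univ.filter fun i => (j : ℕ) < a i).card := by
  funext x
  have hcount : ∀ j : ℕ, (Finset.univ.filter fun i => j < a i).card ≤ h := fun j =>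
    (Finset.card_le_univ _).trans_eq (Fintype.card_fin h)
  -- As `a` is monotone, the indices with j < a i form a final segment, so the clamped unit slopes
  -- add up to a single `max`.
  have hupper : ∀ (j : ℕ) (i : Fin h),
      h - (Finset.univ.filter fun i => j < a i).card ≤ (i : ℕ) ↔ j < a i := by
    intro j i
    constructor
    · intro hi
      by_contra hcon
      have hsub : (Finset.univ.filter fun i => j < a i) ⊆ Finset.Ioi i := by
        intro l hl
        rw [Finset.mem_filter] at hl
        rw [Finset.mem_Ioi]
        by_contra hli
        have := ha (not_lt.1 hli)
        omega
      have := Finset.card_le_card hsub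
      rw [Fin.card_Ioi] at this
      have := i.2
      omega
    · intro hi
      have hsub : Finset.Ici i ⊆ (Finset.univ.filter fun i => j < a i) := by
        intro l hl
        rw [Finset.mem_Ici] at hl
        rw [Finset.mem_filter]
        exact ⟨Finset.mem_univ _, hi.trans_le (ha hl)⟩
      have := Finset.card_le_card hsub
      rw [Fin.card_Ici] at this
      omega
  have ha' : ∀ i, (a i : ℝ) = ∑ j : Fin e, if (j : ℕ) < a i then 1 else 0 := by
    intro i
    rw [Fin.sum_univ_eq_sum_range (fun j => if j < a i then (1 : ℝ) else 0) e, ← Finset.sum_filter,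
      Finset.sum_const, nsmul_one]
    congr 1
    have : (Finset.range e).filter (fun j => j < a i) = Finset.range (a i) := by
      ext j
      have := hae i
      simp only [Finset.mem_range, Finset.mem_filter]
      omega
    rw [this, Finset.card_range]
  unfold polygonOfSlopes polygonOf
  simp only [← sum_clamp_eq_max (hcount _) x.2.2, hupper]
  rw [Finset.sum_comm, Finset.mul_sum]
  refine Finset.sum_congr rfl fun i _ => ?_
  rw [ha', div_mul_eq_mul_div, Finset.sum_mul]
  simp only [ite_mul, one_mul, zero_mul]
  ring

/-- The Hodge polygon is determined by the ranks of the powers of `T`. -/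
theorem hodgePolygon_eq_polygonOf [Module.Finite k V] {h e : ℕ} {T : Module.End k V}
    (hT : T ^ e = 0)
    (hgen : Module.finrank k V ≤ Module.finrank k (LinearMap.range T) + h) {c : Fin e → ℕ}
    (hc : ∀ j : Fin e, Module.finrank k (LinearMap.range (T ^ (j : ℕ))) =
      Module.finrank k (LinearMap.range (T ^ ((j : ℕ) + 1))) + c j) :
    hodgePolygon h e T = polygonOf h c := by
  have H := exists_isHodgeType (h := h) hT hgen
  rw [hodgePolygon, dif_pos H]
  obtain ⟨hmono, hle, f, hf⟩ := H.choose_spec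
  rw [polygonOfSlopes_eq_polygonOf hmono hle]
  congr 1
  funext j
  have h1 := hc j
  rw [finrank_range_pow_of_equiv f hf, finrank_range_pow_of_equiv f hf] at h1
  have h2 : ∑ i, (H.choose i - (j : ℕ)) = ∑ i, (H.choose i - ((j : ℕ) + 1)) +
      (Finset.univ.filter fun i => (j : ℕ) < H.choose i).card := by
    rw [Finset.card_filter, ← Finset.sum_add_distrib]
    refine Finset.sum_congr rfl fun i _ => ?_
    split_ifs <;> omega
  omega

end Hodge

/-! ### Comparison of polygons with given entries -/

section Polygons

theorem polygonOf_mem_polygonSet {h N : ℕ} {c : Fin N → ℕ} (hc : ∀ i, c i ≤ h) :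
    polygonOf h c ∈ polygonSet h N := by
  have hc' : ∀ i, (c i : ℝ) ≤ h := fun i => Nat.cast_le.2 (hc i)
  refine ⟨?_, ?_, ?_⟩
  · unfold HPolygon.left polygonOf
    rw [Finset.sum_eq_zero, mul_zero]
    intro i _
    exact max_eq_left (by linarith [hc' i])
  · have hconv : ConvexOn ℝ (Set.Icc (0 : ℝ) h)
        (fun x : ℝ => (1 / (N : ℝ)) • ∑ i, max 0 (x + ((c i : ℝ) - h))) := by
      refine ConvexOn.smul (by positivity) ?_
      refine ⟨convex_Icc _ _, fun x _ y _ a b ha hb hab => ?_⟩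
      rw [Finset.smul_sum, Finset.smul_sum, ← Finset.sum_add_distrib]
      refine Finset.sum_le_sum fun i _ => ?_
      simp only [smul_eq_mul]
      refine max_le (by positivity) ?_
      have h1 := mul_le_mul_of_nonneg_left (le_max_right 0 (x + ((c i : ℝ) - h))) ha
      have h2 := mul_le_mul_of_nonneg_left (le_max_right 0 (y + ((c i : ℝ) - h))) hb
      have h3 : a * ((c i : ℝ) - h) + b * (c i - h) = c i - h := by rw [← add_mul, hab, one_mul]
      linarith
    refine hconv.congr fun x hx => ?_
    rw [Set.IccExtend_of_mem _ _ hx]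
    simp [polygonOf, add_sub_assoc]
  · intro i hi
    -- Summand j starts growing at the integer h - c j, so on [i, i + 1] it has slope 1 if h ≤ i + c
    -- j and slope 0 otherwise.
    refine ⟨(Finset.univ.filter fun j => h ≤ i + c j).card,
      (Finset.card_le_univ _).trans_eq (Fintype.card_fin N), fun x y hx hxy hy => ?_⟩
    unfold polygonOf
    rw [← mul_sub, ← Finset.sum_sub_distrib, Finset.card_filter, Nat.cast_sum,
      one_div_mul_eq_div, div_mul_eq_mul_div, Finset.sum_mul]
    congr 1
    refine Finset.sum_congr rfl fun j _ => ?_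
    split_ifs with hj
    · have : (h : ℝ) ≤ i + c j := by exact_mod_cast hj
      rw [max_eq_right (by linarith), max_eq_right (by linarith)]
      push_cast
      ring
    · have : (i : ℝ) + c j + 1 ≤ h := by exact_mod_cast not_le.1 hj
      rw [max_eq_left (by linarith), max_eq_left (by linarith)]
      simp

theorem polygonOf_right {h N : ℕ} (c : Fin N → ℕ) :
    (polygonOf h c).right = (∑ i, (c i : ℝ)) / N := by
  unfold HPolygon.right polygonOf
  rw [one_div_mul_eq_div]
  congr 1
  refine Finset.sum_congr rfl fun i _ => ?_
  rw [add_sub_cancel_left]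
  exact max_eq_right (Nat.cast_nonneg _)

theorem sum_eq_of_polygonOf_right_eq {h N : ℕ} (hN : N ≠ 0) {c : Fin N → ℕ} {s : ℕ}
    (H : (polygonOf h c).right = (s : ℝ) / N) : ∑ i, c i = s := by
  rw [polygonOf_right, div_left_inj' (Nat.cast_ne_zero.2 hN)] at H
  exact_mod_cast H

theorem polygonOf_le_iff {h N : ℕ} (hN : N ≠ 0) {c c' : Fin N → ℕ} :
    polygonOf h c ≤ polygonOf h c' ↔ ∀ x : Set.Icc (0 : ℝ) (h : ℝ),
      ∑ i, max 0 ((x : ℝ) + c i - h) ≤ ∑ i, max 0 ((x : ℝ) + c' i - h) := by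
  have : (0 : ℝ) < 1 / N := by positivity
  exact forall_congr' fun x => mul_le_mul_iff_right₀ this

/-- At x = h - b the upper polygon vanishes, which forces every summand of the lower one to vanish
there. This compares largest entries. -/
theorem le_of_polygonOf_le {h N : ℕ} (hN : N ≠ 0) {c c' : Fin N → ℕ}
    (H : polygonOf h c ≤ polygonOf h c') {b : ℕ} (hb : b ≤ h) (hc' : ∀ i, c' i ≤ b) (i : Fin N) :
    c i ≤ b := by
  have hb' : (b : ℝ) ≤ h := Nat.cast_le.2 hb
  have h1 := (polygonOf_le_iff hN).1 H ⟨(h : ℝ) - b, by linarith, by simp⟩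
  rw [Finset.sum_eq_zero (s := Finset.univ) (f := fun i => max 0 ((h : ℝ) - b + c' i - h))] at h1
  · have h2 := (Finset.single_le_sum (f := fun i => max 0 ((h : ℝ) - b + c i - h))
      (fun i _ => le_max_left _ _) (Finset.mem_univ i)).trans h1
    have h3 := (le_max_right 0 ((h : ℝ) - b + c i - h)).trans h2
    have : (c i : ℝ) ≤ b := by linarith
    exact_mod_cast this
  · intro j _
    have : (c' j : ℝ) ≤ b := Nat.cast_le.2 (hc' j)
    exact max_eq_left (by linarith)

/-- At x = h - b no summand of the upper polygon is truncated, so its sum is the untruncated one. An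
entry c i < b would make the lower sum strictly larger. This compares smallest entries. -/
theorem ge_of_polygonOf_le {h N : ℕ} (hN : N ≠ 0) {c c' : Fin N → ℕ}
    (H : polygonOf h c ≤ polygonOf h c') (hsum : ∑ i, c i = ∑ i, c' i) {b : ℕ} (hb : b ≤ h)
    (hc' : ∀ i, b ≤ c' i) (i : Fin N) : b ≤ c i := by
  have hb' : (b : ℝ) ≤ h := Nat.cast_le.2 hb
  have h1 := (polygonOf_le_iff hN).1 H ⟨(h : ℝ) - b, by linarith, by simp⟩
  by_contra! hi
  have hi' : (c i : ℝ) < b := Nat.cast_lt.2 hi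
  have h2 : ∑ i, max 0 ((h : ℝ) - b + c' i - h) = ∑ i, ((c' i : ℝ) - b) := by
    refine Finset.sum_congr rfl fun j _ => ?_
    have : (b : ℝ) ≤ c' j := Nat.cast_le.2 (hc' j)
    rw [max_eq_right (by linarith)]
    ring
  have h3 : ∑ i, ((c i : ℝ) - b) < ∑ i, max 0 ((h : ℝ) - b + c i - h) := by
    refine Finset.sum_lt_sum (fun j _ => ?_) ⟨i, Finset.mem_univ i, ?_⟩
    · exact le_max_of_le_right (by linarith)
    · exact lt_max_of_lt_left (by linarith)
  have h4 : ∑ i, ((c i : ℝ) - b) = ∑ i, ((c' i : ℝ) - b) := by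
    rw [Finset.sum_sub_distrib, Finset.sum_sub_distrib]
    congr 1
    exact_mod_cast hsum
  dsimp only at h1
  linarith

theorem star_polygonOf (h a b c : ℕ) :
    HPolygon.star 2 1 (polygonOf h ![a, b]) (polygonOf h ![c]) = polygonOf h ![a, b, c] := by
  funext x
  simp only [HPolygon.star, polygonOf, Fin.sum_univ_succ, Fin.sum_univ_zero, Matrix.cons_val_zero,
    Matrix.cons_val_succ]
  push_cast
  ring

/-- Majorization: with equal totals, it suffices to compare sums of the positive terms of the left
side, according to how many there are. -/
theorem polygonOf_pair_le {h a b a' b' : ℕ} (hs : a + b = a' + b') (ha : a ≤ a') (hb : b ≤ a') :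
    polygonOf h ![a, b] ≤ polygonOf h ![a', b'] := by
  rw [polygonOf_le_iff two_ne_zero]
  intro x
  simp only [Fin.sum_univ_two, Matrix.cons_val_zero, Matrix.cons_val_one]
  have hs' : (a : ℝ) + b = a' + b' := by exact_mod_cast hs
  have ha' : (a : ℝ) ≤ a' := Nat.cast_le.2 ha
  have hb' : (b : ℝ) ≤ a' := Nat.cast_le.2 hb
  have l1 := le_max_left 0 ((x : ℝ) + a' - h)
  have l2 := le_max_left 0 ((x : ℝ) + b' - h)
  have r1 := le_max_right 0 ((x : ℝ) + a' - h)
  have r2 := le_max_right 0 ((x : ℝ) + b' - h)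
  rcases max_cases 0 ((x : ℝ) + a - h) with h1 | h1 <;>
  rcases max_cases 0 ((x : ℝ) + b - h) with h2 | h2 <;> linarith

theorem polygonOf_triple_le {h a b c a' b' c' : ℕ} (hs : a + b + c = a' + b' + c')
    (h1 : a ≤ a') (h2 : b ≤ a') (h3 : c ≤ a') (h4 : c' ≤ a) (h5 : c' ≤ b) (h6 : c' ≤ c) :
    polygonOf h ![a, b, c] ≤ polygonOf h ![a', b', c'] := by
  rw [polygonOf_le_iff three_ne_zero]
  intro x
  simp only [Fin.sum_univ_three, Matrix.cons_val_zero, Matrix.cons_val_one, Matrix.cons_val]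
  have hs' : (a : ℝ) + b + c = a' + b' + c' := by exact_mod_cast hs
  rify at h1 h2 h3 h4 h5 h6
  have l1 := le_max_left 0 ((x : ℝ) + a' - h)
  have l2 := le_max_left 0 ((x : ℝ) + b' - h)
  have l3 := le_max_left 0 ((x : ℝ) + c' - h)
  have r1 := le_max_right 0 ((x : ℝ) + a' - h)
  have r2 := le_max_right 0 ((x : ℝ) + b' - h)
  have r3 := le_max_right 0 ((x : ℝ) + c' - h)
  rcases max_cases 0 ((x : ℝ) + a - h) with q1 | q1 <;>
  rcases max_cases 0 ((x : ℝ) + b - h) with q2 | q2 <;>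
  rcases max_cases 0 ((x : ℝ) + c - h) with q3 | q3 <;> linarith

theorem polygonOf_pair_injective {h a b a' b' : ℕ} (hab : b ≤ a) (hah : a ≤ h) (hab' : b' ≤ a')
    (hah' : a' ≤ h) (hs : a + b = a' + b')
    (H : polygonOf h ![a, b] = polygonOf h ![a', b']) : a = a' ∧ b = b' := by
  have h1 := le_of_polygonOf_le two_ne_zero H.le hah' (by simp [Fin.forall_fin_two, hab']) 0
  have h2 := le_of_polygonOf_le two_ne_zero H.ge hah (by simp [Fin.forall_fin_two, hab]) 0
  simp only [Matrix.cons_val_zero] at h1 h2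
  omega

/-- The largest and smallest entries are recovered by comparison in both directions, the middle one
from the total. -/
theorem polygonOf_triple_injective {h a b c a' b' c' : ℕ} (hbc : c ≤ b) (hab : b ≤ a)
    (hah : a ≤ h) (hbc' : c' ≤ b') (hab' : b' ≤ a') (hah' : a' ≤ h)
    (hs : a + b + c = a' + b' + c')
    (H : polygonOf h ![a, b, c] = polygonOf h ![a', b', c']) : a = a' ∧ b = b' ∧ c = c' := by
  have hs' : ∑ i, ![a, b, c] i = ∑ i, ![a', b', c'] i := by simpa [Fin.sum_univ_three] using hs
  have h1 := le_of_polygonOf_le three_ne_zero H.le hah'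
    (by simp [Fin.forall_fin_succ, hab', hbc'.trans hab']) 0
  have h2 := le_of_polygonOf_le three_ne_zero H.ge hah
    (by simp [Fin.forall_fin_succ, hab, hbc.trans hab]) 0
  have h3 := ge_of_polygonOf_le three_ne_zero H.le hs' (b := c') (by omega)
    (by simp [Fin.forall_fin_succ, hbc', hbc'.trans hab']) 2
  have h4 := ge_of_polygonOf_le three_ne_zero H.ge hs'.symm (b := c) (by omega)
    (by simp [Fin.forall_fin_succ, hbc, hbc.trans hab]) 2
  simp only [Matrix.cons_val_zero, Matrix.cons_val] at h1 h2 h3 h4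
  omega

end Polygons

/-! ### Truncated polynomial modules as nilpotent endomorphisms -/

section OfEnd

variable {k : Type u} [Field k]

theorem mk_smul_eq_aeval_mulT {e : ℕ} {M : Type u} [AddCommGroup M] [Module k M]
    [Module (TruncPoly k e) M] [IsScalarTower k (TruncPoly k e) M] (p : k[X]) (x : M) :
    (Ideal.Quotient.mk (Ideal.span {(X : k[X]) ^ e}) p : TruncPoly k e) • x =
      aeval (mulT k e M) p x := by
  have h1 : aeval (mulT k e M) p = Algebra.lsmul k k M
      (aeval (Ideal.Quotient.mkₐ k (Ideal.span {(X : k[X]) ^ e}) X) p) :=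
    aeval_algHom_apply (Algebra.lsmul k k M : TruncPoly k e →ₐ[k] Module.End k M) _ p
  rw [h1, aeval_algHom_apply, aeval_X_left_apply]
  rfl

/-- The `k[T]/T^e`-module structure defined by a nilpotent endomorphism. -/
abbrev moduleOfEnd {V : Type u} [AddCommGroup V] [Module k V] {e : ℕ} (T : Module.End k V)
    (hT : T ^ e = 0) : Module (TruncPoly k e) V :=
  Module.compHom V (Ideal.Quotient.lift (Ideal.span {(X : k[X]) ^ e})
    (aeval T : k[X] →ₐ[k] Module.End k V).toRingHom fun p hp => by
      obtain ⟨q, rfl⟩ := Ideal.mem_span_singleton.1 hp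
      simp [hT] : TruncPoly k e →+* Module.End k V)

variable {h e : ℕ} {d : Fin e → ℕ}

theorem PRModule.finrank_fil_succ (M : PRModule k h d) (i : Fin e) :
    Module.finrank k (M.fil i.succ) = Module.finrank k (M.fil i.castSucc) + d i := by
  have := M.finite
  have hle := M.datum.fil_mono (Fin.castSucc_lt_succ (i := i)).le
  rw [← M.datum.finrank_quot i, ← (Submodule.submoduleOfEquivOfLe hle).finrank_eq, add_comm]
  exact (Submodule.finrank_quotient_add_finrank _).symm

/-- The module with PR datum given by a nilpotent endomorphism and a filtration. -/
def PRModule.ofEnd {V : Type u} [AddCommGroup V] [Module k V] [Module.Finite k V]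
    (T : Module.End k V) (hT : T ^ e = 0) (F : Fin (e + 1) → Submodule k V) (h0 : F 0 = ⊥)
    (hlast : F (Fin.last e) = ⊤) (hmono : Monotone F)
    (hTF : ∀ i : Fin e, ∀ x ∈ F i.succ, T x ∈ F i.castSucc)
    (hd : ∀ i : Fin e, Module.finrank k (F i.succ) = Module.finrank k (F i.castSucc) + d i)
    (hgen : ∃ s : Finset V, s.card ≤ h ∧
      ∀ N : Submodule k V, (∀ x ∈ s, x ∈ N) → (∀ x ∈ N, T x ∈ N) → N = ⊤) :
    PRModule k h d :=
  letI := moduleOfEnd T hT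
  haveI : IsScalarTower k (TruncPoly k e) V := ⟨fun c r v => by
    obtain ⟨p, rfl⟩ := Ideal.Quotient.mk_surjective r
    change aeval T (c • p) v = c • aeval T p v
    rw [map_smul, LinearMap.smul_apply]⟩
  have hmul : ∀ x, mulT k e V x = T x := fun x => by
    change aeval T X x = T x
    rw [aeval_X]
  { carrier := V
    finite := inferInstance
    generated := by
      obtain ⟨s, hs, H⟩ := hgen
      refine ⟨s, hs, ?_⟩
      have := H ((Submodule.span (TruncPoly k e) (s : Set V)).restrictScalars k)
        (fun x hx => Submodule.subset_span hx) fun x hx => by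
          rw [← hmul]
          exact Submodule.smul_mem (Submodule.span (TruncPoly k e) (s : Set V)) _ hx
      exact (Submodule.restrictScalars_eq_top_iff k (TruncPoly k e) V).1 this
    datum :=
      { fil := F
        fil_zero := h0
        fil_last := hlast
        fil_mono := hmono
        T_mem := fun i x hx => by rw [hmul]; exact hTF i x hx
        finrank_quot := fun i => by
          have hle := hmono (Fin.castSucc_lt_succ (i := i)).le
          have h1 := Submodule.finrank_quotient_add_finrank
            ((F i.castSucc).submoduleOf (F i.succ))
          rw [(Submodule.submoduleOfEquivOfLe hle).finrank_eq, hd i, add_comm] at h1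
          exact Nat.add_left_cancel h1 } }

theorem PRModule.Iso.of_linearEquiv {M N : PRModule k h d} (g : M.carrier ≃ₗ[k] N.carrier)
    (hg : ∀ x, g (M.T x) = N.T (g x)) (hfil : ∀ i x, x ∈ M.fil i ↔ g x ∈ N.fil i) :
    M.Iso N := by
  have hpow : ∀ (m : ℕ) x, g ((M.T ^ m) x) = (N.T ^ m) (g x) := by
    intro m
    induction m with
    | zero => simp
    | succ m ih => intro x; rw [pow_succ', pow_succ', Module.End.mul_apply, hg, ih]; rfl
  have hsmul : ∀ (r : TruncPoly k e) x, g (r • x) = r • g x := by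
    intro r x
    obtain ⟨p, rfl⟩ := Ideal.Quotient.mk_surjective r
    rw [mk_smul_eq_aeval_mulT, mk_smul_eq_aeval_mulT, aeval_endomorphism, aeval_endomorphism,
      Polynomial.sum, Polynomial.sum, map_sum]
    refine Finset.sum_congr rfl fun m _ => ?_
    rw [map_smul, hpow]
  exact ⟨{ g.toAddEquiv with map_smul' := hsmul }, hfil⟩

/-- A module generated by at most `h` elements satisfies `dim M / T M ≤ h`. -/
theorem PRModule.finrank_le (M : PRModule k h d) :
    Module.finrank k M.carrier ≤ Module.finrank k (LinearMap.range M.T) + h := by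
  have := M.finite
  obtain ⟨s, hs, hspan⟩ := M.generated
  have htop : LinearMap.range M.T ⊔ Submodule.span k (s : Set M.carrier) = ⊤ := by
    rw [eq_top_iff]
    intro x _
    have hx : x ∈ Submodule.span (TruncPoly k e) (s : Set M.carrier) := by
      rw [hspan]; trivial
    induction hx using Submodule.span_induction with
    | mem x hx => exact Submodule.mem_sup_right (Submodule.subset_span hx)
    | zero => exact zero_mem _
    | add x y _ _ hx hy => exact add_mem (hx trivial) (hy trivial)
    | smul r x _ hx =>
      obtain ⟨p, rfl⟩ := Ideal.Quotient.mk_surjective r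
      -- Splitting off the constant term of p: the rest acts through the range of `T`, the constant
      -- acts as a scalar.
      rw [mk_smul_eq_aeval_mulT, ← p.divX_mul_X_add, mul_comm, map_add, map_mul, aeval_X, aeval_C]
      exact add_mem (Submodule.mem_sup_left ⟨_, rfl⟩) (Submodule.smul_mem _ _ (hx trivial))
  have h1 := Submodule.finrank_add_le_finrank_add_finrank (LinearMap.range M.T)
    (Submodule.span k (s : Set M.carrier))
  rw [htop, finrank_top] at h1
  have h2 := finrank_span_finset_le_card (R := k) s
  unfold Set.finrank at h2
  omega

end OfEnd

/-! ### Direct sums of adapted Jordan blocks -/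

section Model

/-- The types of Jordan blocks adapted to a filtration with three steps, given by the steps
that the successive vectors of the block belong to. -/
def blockChain : Fin 7 → List (Fin 4) := ![[1], [2], [3], [2, 1], [3, 1], [3, 2], [3, 2, 1]]

/-- The basis of the direct sum of `n t` blocks of type `t`. -/
abbrev BlockIndex (n : Fin 7 → ℕ) : Type :=
  Σ t : Fin 7, Fin (blockChain t).length × Fin (n t)

variable (k : Type u) [Field k] (n : Fin 7 → ℕ)

/-- The action of `T` on the direct sum of `n t` blocks of type `t`. -/
def blockT : Module.End k (BlockIndex n →₀ k) :=
  Finsupp.linearCombination k fun x =>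
    if hx : (x.2.1 : ℕ) + 1 < (blockChain x.1).length then
      Finsupp.single ⟨x.1, ⟨_, hx⟩, x.2.2⟩ 1 else 0

/-- The subspace spanned by the basis vectors whose position in the blocks satisfies `q`. -/
def blockSpan (q : (t : Fin 7) → Fin (blockChain t).length → Prop) :
    Submodule k (BlockIndex n →₀ k) :=
  Finsupp.supported k k {x | q x.1 x.2.1}

variable {n}

/-- The condition `q` ignores which copy of a block is meant, so every dimension in the model is a
linear form in `n` whose coefficients are found by a finite check. -/
theorem finrank_blockSpan (q : (t : Fin 7) → Fin (blockChain t).length → Prop)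
    [∀ t j, Decidable (q t j)] :
    Module.finrank k (blockSpan k n q) =
      ∑ t, (Finset.univ.filter fun j => q t j).card * n t := by
  classical
  rw [blockSpan, (Finsupp.supportedEquivFinsupp _).finrank_eq, Module.finrank_finsupp_self]
  change Fintype.card {x : BlockIndex n // q x.1 x.2.1} = _
  rw [Fintype.card_subtype, Finset.card_filter, Fintype.sum_sigma]
  refine Finset.sum_congr rfl fun t _ => ?_
  rw [Fintype.sum_prod_type, Finset.card_filter, Finset.sum_mul]
  refine Finset.sum_congr rfl fun j _ => ?_
  by_cases hj : q t j <;> simp [hj]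

theorem blockT_single (x : BlockIndex n) : blockT k n (Finsupp.single x 1) =
    if hx : (x.2.1 : ℕ) + 1 < (blockChain x.1).length then
      Finsupp.single ⟨x.1, ⟨_, hx⟩, x.2.2⟩ 1 else 0 := by
  simp [blockT]

theorem map_blockT_blockSpan (q : (t : Fin 7) → Fin (blockChain t).length → Prop) :
    (blockSpan k n q).map (blockT k n) =
      blockSpan k n fun t j => ∃ i, q t i ∧ (i : ℕ) + 1 = j := by
  apply le_antisymm
  · rw [blockSpan, Finsupp.supported_eq_span_single, Submodule.map_span, Submodule.span_le]
    rintro _ ⟨_, ⟨x, hx, rfl⟩, rfl⟩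
    rw [blockT_single]
    split_ifs with hlt
    · exact Finsupp.single_mem_supported k 1 ⟨_, hx, rfl⟩
    · exact zero_mem _
  · rw [blockSpan, Finsupp.supported_eq_span_single, Submodule.span_le]
    rintro _ ⟨⟨t, j, i⟩, ⟨j', hq, hj⟩, rfl⟩
    refine ⟨Finsupp.single ⟨t, j', i⟩ 1, Finsupp.single_mem_supported k 1 hq, ?_⟩
    have hlt : (j' : ℕ) + 1 < (blockChain t).length := hj ▸ j.2
    rw [blockT_single, dif_pos hlt]
    congr

theorem blockSpan_sup (q q' : (t : Fin 7) → Fin (blockChain t).length → Prop) :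
    blockSpan k n q ⊔ blockSpan k n q' = blockSpan k n fun t j => q t j ∨ q' t j :=
  (Finsupp.supported_union _ _).symm

theorem blockSpan_mono {q q' : (t : Fin 7) → Fin (blockChain t).length → Prop}
    (hq : ∀ t j, q t j → q' t j) : blockSpan k n q ≤ blockSpan k n q' :=
  Finsupp.supported_mono fun _ hx => hq _ _ hx

theorem blockSpan_eq_top {q : (t : Fin 7) → Fin (blockChain t).length → Prop}
    (hq : ∀ t j, q t j) : blockSpan k n q = ⊤ := by
  have : {x : BlockIndex n | q x.1 x.2.1} = Set.univ := Set.eq_univ_of_forall fun x => hq _ _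
  rw [blockSpan, this, Finsupp.supported_univ]

theorem blockSpan_eq_bot {q : (t : Fin 7) → Fin (blockChain t).length → Prop}
    (hq : ∀ t j, ¬ q t j) : blockSpan k n q = ⊥ := by
  have : {x : BlockIndex n | q x.1 x.2.1} = ∅ := Set.eq_empty_of_forall_notMem fun x => hq _ _
  rw [blockSpan, this, Finsupp.supported_empty]

/-- The filtration on the direct sum of `n t` blocks of type `t`. -/
def blockFil (l : Fin 4) : Submodule k (BlockIndex n →₀ k) :=
  blockSpan k n fun t j => (blockChain t).get j ≤ l

theorem finrank_blockFil (l : Fin 4) : Module.finrank k (blockFil k (n := n) l) =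
    ![0, n 0 + n 3 + n 4 + n 6, n 0 + n 1 + 2 * n 3 + n 4 + n 5 + 2 * n 6,
      n 0 + n 1 + n 2 + 2 * n 3 + 2 * n 4 + 2 * n 5 + 3 * n 6] l := by
  rw [blockFil, finrank_blockSpan]
  -- Rows are block types, columns are filtration steps.
  have h : ∀ t l, (Finset.univ.filter fun j => (blockChain t).get j ≤ l).card =
      ![![0, 1, 1, 1], ![0, 0, 1, 1], ![0, 0, 0, 1], ![0, 1, 2, 2], ![0, 1, 1, 2], ![0, 0, 1, 2],
        ![0, 1, 2, 3]] t l := by decide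
  simp only [h, Fin.sum_univ_seven]
  fin_cases l <;> simp

theorem map_blockT_blockFil_succ (i : Fin 3) :
    (blockFil k (n := n) i.succ).map (blockT k n) ≤ blockFil k i.castSucc := by
  rw [blockFil, map_blockT_blockSpan]
  refine blockSpan_mono k fun t j => ?_
  revert t j i
  decide

theorem range_blockT : LinearMap.range (blockT k n) = blockSpan k n fun _ j => (j : ℕ) ≠ 0 := by
  rw [← Submodule.map_top, ← blockSpan_eq_top k (q := fun _ _ => True) fun _ _ => trivial,
    map_blockT_blockSpan]
  congr! 3 with t j
  revert t j
  decide

theorem finrank_range_blockT : Module.finrank k (LinearMap.range (blockT k n)) =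
    n 3 + n 4 + n 5 + 2 * n 6 := by
  rw [range_blockT, finrank_blockSpan]
  have h : ∀ t, (Finset.univ.filter fun j : Fin (blockChain t).length => (j : ℕ) ≠ 0).card =
      ![0, 0, 0, 1, 1, 1, 2] t := by decide
  simp only [h, Fin.sum_univ_seven]
  simp

theorem range_blockT_sq : LinearMap.range (blockT k n ^ 2) =
    blockSpan k n fun _ j => (j : ℕ) = 2 := by
  rw [sq, Module.End.mul_eq_comp, LinearMap.range_comp, range_blockT, map_blockT_blockSpan]
  congr! 3 with t j
  revert t j
  decide

theorem finrank_range_blockT_sq : Module.finrank k (LinearMap.range (blockT k n ^ 2)) = n 6 := by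
  rw [range_blockT_sq, finrank_blockSpan]
  have h : ∀ t, (Finset.univ.filter fun j : Fin (blockChain t).length => (j : ℕ) = 2).card =
      ![0, 0, 0, 0, 0, 0, 1] t := by decide
  simp only [h, Fin.sum_univ_seven]
  simp

theorem blockT_pow_three : blockT k n ^ 3 = 0 := by
  rw [← LinearMap.range_eq_bot, pow_succ', Module.End.mul_eq_comp, LinearMap.range_comp,
    range_blockT_sq, map_blockT_blockSpan]
  exact blockSpan_eq_bot k (by decide)

theorem finrank_map_blockT_blockFil_two :
    Module.finrank k ((blockFil k (n := n) 2).map (blockT k n)) = n 3 + n 6 := by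
  rw [blockFil, map_blockT_blockSpan, finrank_blockSpan]
  have h : ∀ t, (Finset.univ.filter fun j : Fin (blockChain t).length =>
      ∃ i, (blockChain t).get i ≤ 2 ∧ (i : ℕ) + 1 = j).card = ![0, 0, 0, 1, 0, 0, 1] t := by decide
  simp only [h, Fin.sum_univ_seven]
  simp

theorem finrank_range_blockT_sup_blockFil_one :
    Module.finrank k (LinearMap.range (blockT k n) ⊔ blockFil k (n := n) 1 : Submodule k _) =
      n 0 + n 3 + n 4 + n 5 + 2 * n 6 := by
  rw [blockFil, range_blockT, blockSpan_sup, finrank_blockSpan]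
  have h : ∀ t, (Finset.univ.filter fun j : Fin (blockChain t).length =>
      (j : ℕ) ≠ 0 ∨ (blockChain t).get j ≤ 1).card = ![1, 0, 0, 1, 1, 1, 2] t := by decide
  simp only [h, Fin.sum_univ_seven]
  simp

/-- The direct sum of `n t` blocks of type `t`, as a module with PR datum. -/
def blockModule {h : ℕ} {d : Fin 3 → ℕ} (hgen : ∑ t, n t ≤ h)
    (hd : d = ![n 0 + n 3 + n 4 + n 6, n 1 + n 3 + n 5 + n 6, n 2 + n 4 + n 5 + n 6]) :
    PRModule k h d :=
  PRModule.ofEnd (blockT k n) (blockT_pow_three k) (blockFil k)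
    (blockSpan_eq_bot k (by decide)) (blockSpan_eq_top k (by decide))
    (fun _ _ hl => blockSpan_mono k fun _ _ hj => hj.trans hl)
    (fun i x hx => map_blockT_blockFil_succ k i ⟨x, hx, rfl⟩)
    (fun i => by
      rw [finrank_blockFil, finrank_blockFil, hd]
      fin_cases i <;> simp <;> ring)
    (by
      classical
      have hlen : ∀ t, 0 < (blockChain t).length := by decide
      refine ⟨Finset.univ.image fun x : Σ t, Fin (n t) =>
        Finsupp.single (⟨x.1, ⟨0, hlen x.1⟩, x.2⟩ : BlockIndex n) (1 : k), ?_, fun N hN hT => ?_⟩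
      · refine Finset.card_image_le.trans ?_
        simpa using hgen
      · rw [eq_top_iff, ← Finsupp.supported_univ, Finsupp.supported_eq_span_single,
          Submodule.span_le]
        rintro _ ⟨⟨t, ⟨j, hj⟩, i⟩, -, rfl⟩
        induction j with
        | zero => exact hN _ (Finset.mem_image.2 ⟨⟨t, i⟩, Finset.mem_univ _, rfl⟩)
        | succ j ih =>
          have := hT _ (ih (by omega))
          rwa [blockT_single, dif_pos hj] at this)

theorem blockModule_T {h : ℕ} {d : Fin 3 → ℕ} (hgen : ∑ t, n t ≤ h)
    (hd : d = ![n 0 + n 3 + n 4 + n 6, n 1 + n 3 + n 5 + n 6, n 2 + n 4 + n 5 + n 6]) :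
    (blockModule k hgen hd).T = blockT k n := by
  refine LinearMap.ext fun x => ?_
  exact LinearMap.congr_fun (aeval_X (blockT k n)) x

theorem blockModule_fil {h : ℕ} {d : Fin 3 → ℕ} (hgen : ∑ t, n t ≤ h)
    (hd : d = ![n 0 + n 3 + n 4 + n 6, n 1 + n 3 + n 5 + n 6, n 2 + n 4 + n 5 + n 6]) :
    (blockModule k hgen hd).fil = blockFil k := rfl

end Model

/-! ### Decomposition into adapted blocks -/

section Decomposition

variable {k : Type u} [Field k] {V : Type u} [AddCommGroup V] [Module k V] [Module.Finite k V]

/-- A basis of a complement of `P` in `Q`; such families serve as heads of blocks. Independence is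
not recorded, because the dimension count will supply it. -/
theorem exists_family_sup_span {P Q : Submodule k V} (hPQ : P ≤ Q) :
    ∃ (m : ℕ) (u : Fin m → V), Q = P ⊔ Submodule.span k (Set.range u) ∧
      Module.finrank k Q = Module.finrank k P + m := by
  obtain ⟨C, hC⟩ := Submodule.exists_isCompl (P.submoduleOf Q)
  let b := Module.finBasis k C
  refine ⟨_, fun i => (b i : Q), ?_, ?_⟩
  · have hspan : Submodule.span k (Set.range fun i => ((b i : Q) : V)) = C.map Q.subtype := by
      have h1 : (Set.range fun i => ((b i : Q) : V)) =
          (Q.subtype ∘ₗ C.subtype) '' Set.range b := by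
        rw [← Set.range_comp]
        rfl
      rw [h1, ← Submodule.map_span, b.span_eq, Submodule.map_comp, Submodule.map_top,
        Submodule.range_subtype]
    have h2 := congrArg (Submodule.map Q.subtype) hC.sup_eq_top
    rw [Submodule.map_sup, Submodule.map_subtype_top, Submodule.submoduleOf,
      Submodule.map_comap_subtype, inf_eq_right.2 hPQ] at h2
    rw [hspan, h2]
  · rw [← (Submodule.submoduleOfEquivOfLe hPQ).finrank_eq]
    exact (Submodule.finrank_add_eq_of_isCompl hC).symm

theorem finrank_map_add_finrank_inf_ker (T : Module.End k V) (P : Submodule k V) :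
    Module.finrank k (P.map T) + Module.finrank k (P ⊓ LinearMap.ker T : Submodule k V) =
      Module.finrank k P := by
  have h1 := (T.domRestrict P).finrank_range_add_finrank_ker
  rw [LinearMap.range_domRestrict] at h1
  rw [← h1]
  congr 1
  have h2 : (LinearMap.ker (T.domRestrict P)).map P.subtype = P ⊓ LinearMap.ker T := by
    rw [LinearMap.domRestrict, LinearMap.ker_comp, Submodule.map_comap_subtype]
  rw [← h2, Submodule.finrank_map_subtype_eq]

/-- The vectors of the Jordan blocks whose heads are the `u t i`. -/
def blockVector (T : Module.End k V) {n : Fin 7 → ℕ} (u : (t : Fin 7) → Fin (n t) → V)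
    (x : BlockIndex n) : V := (T ^ (x.2.1 : ℕ)) (u x.1 x.2.2)

/-- Every filtered nilpotent endomorphism has a basis of adapted Jordan blocks. -/
theorem exists_blockVector (T : Module.End k V) {M₁ M₂ : Submodule k V}
    (h₀ : M₁ ≤ LinearMap.ker T) (h₁₂ : M₁ ≤ M₂) (h₁ : M₂ ≤ M₁.comap T)
    (h₂ : LinearMap.range T ≤ M₂) :
    ∃ (n : Fin 7 → ℕ) (u : (t : Fin 7) → Fin (n t) → V),
      Module.finrank k V = Fintype.card (BlockIndex n) ∧
      (∀ x : BlockIndex n,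
        blockVector T u x ∈ (![⊥, M₁, M₂, ⊤] : Fin 4 → Submodule k V)
          ((blockChain x.1).get x.2.1)) ∧
      (∀ t i, (T ^ (blockChain t).length) (u t i) = 0) ∧
      ∀ l, (![⊥, M₁, M₂, ⊤] : Fin 4 → Submodule k V) l ≤
        Submodule.span k (blockVector T u '' {x | (blockChain x.1).get x.2.1 ≤ l}) := by
  set K := LinearMap.ker T with hK
  set K₂ := LinearMap.ker (T ^ 2) with hK₂
  set C := M₁.comap T with hC
  have hKC : K ≤ C := fun x hx => by
    rw [hC, Submodule.mem_comap, LinearMap.mem_ker.1 hx]; exact zero_mem _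
  have hCK₂ : C ≤ K₂ := fun x hx => by
    rw [hK₂, LinearMap.mem_ker, sq, Module.End.mul_apply]; exact h₀ hx
  have hTK₂ : K₂.map T ≤ M₂ ⊓ K := by
    rintro _ ⟨x, hx, rfl⟩
    refine ⟨h₂ ⟨x, rfl⟩, ?_⟩
    rw [SetLike.mem_coe, hK₂, LinearMap.mem_ker, sq, Module.End.mul_apply] at hx
    exact hx
  have hTC : C.map T ≤ M₁ := Submodule.map_comap_le T M₁
  have hTK : K.map T = ⊥ := LinearMap.le_ker_iff_map.1 le_rfl
  -- `Q t` is the space in which heads of type t are sought, and `P t` is the part of it already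
  -- supplied by other types. The heads are a basis of a complement.
  let P : Fin 7 → Submodule k V :=
    ![C.map T, M₁ ⊔ K₂.map T, M₂ ⊓ K, M₂ ⊓ K ⊔ LinearMap.range T, M₂ ⊔ K, C, K₂]
  let Q : Fin 7 → Submodule k V := ![M₁, M₂ ⊓ K, K, M₂, C, K₂, ⊤]
  have hPQ : ∀ t, P t ≤ Q t := by
    intro t
    fin_cases t
    · exact hTC
    · exact sup_le (le_inf h₁₂ h₀) hTK₂
    · exact inf_le_right
    · exact sup_le inf_le_left h₂
    · exact sup_le h₁ hKC
    · exact hCK₂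
    · exact le_top
  choose n u hu hn using fun t => exists_family_sup_span (hPQ t)
  have hmem : ∀ t i, u t i ∈ Q t := fun t i => by
    rw [hu t]
    exact Submodule.mem_sup_right (Submodule.subset_span ⟨i, rfl⟩)
  refine ⟨n, u, ?_, ?_, ?_, ?_⟩
  -- The seven codimensions, combined with rank–nullity for `T`, `T ^ 2` and the subspaces involved,
  -- give dim V as the total number of block vectors.
  · have e0 : Module.finrank k M₁ = Module.finrank k (C.map T) + n 0 := hn 0
    have e1 : Module.finrank k (M₂ ⊓ K : Submodule k V) =
      Module.finrank k (M₁ ⊔ K₂.map T : Submodule k V) + n 1 := hn 1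
    have e2 : Module.finrank k K = Module.finrank k (M₂ ⊓ K : Submodule k V) + n 2 := hn 2
    have e3 : Module.finrank k M₂ =
      Module.finrank k (M₂ ⊓ K ⊔ LinearMap.range T : Submodule k V) + n 3 := hn 3
    have e4 : Module.finrank k C = Module.finrank k (M₂ ⊔ K : Submodule k V) + n 4 := hn 4
    have e5 : Module.finrank k K₂ = Module.finrank k C + n 5 := hn 5
    have e6 : Module.finrank k (⊤ : Submodule k V) = Module.finrank k K₂ + n 6 := hn 6
    rw [finrank_top] at e6
    have f1 := Submodule.finrank_sup_add_finrank_inf_eq M₂ K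
    have f2 := Submodule.finrank_sup_add_finrank_inf_eq M₁ (K₂.map T)
    have f3 : M₁ ⊓ K₂.map T = C.map T := by
      apply le_antisymm
      · rintro _ ⟨hy, x, hx, rfl⟩
        exact ⟨x, hy, rfl⟩
      · exact le_inf hTC (Submodule.map_mono hCK₂)
    rw [f3] at f2
    have f4 := finrank_map_add_finrank_inf_ker T C
    rw [← hK, inf_eq_right.2 hKC] at f4
    have f5 := finrank_map_add_finrank_inf_ker T K₂
    rw [← hK, inf_eq_right.2 (hKC.trans hCK₂)] at f5
    have f6 := finrank_map_add_finrank_inf_ker T (M₂ ⊓ K ⊔ LinearMap.range T)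
    have f7 : (M₂ ⊓ K ⊔ LinearMap.range T) ⊓ K = M₂ ⊓ K :=
      le_antisymm (inf_le_inf_right K (sup_le inf_le_left h₂)) (le_inf le_sup_left inf_le_right)
    have f8 : (M₂ ⊓ K ⊔ LinearMap.range T).map T = LinearMap.range (T ^ 2) := by
      rw [Submodule.map_sup, sq, Module.End.mul_eq_comp, LinearMap.range_comp, sup_eq_right]
      exact ((Submodule.map_mono inf_le_right).trans hTK.le).trans bot_le
    rw [← hK, f7, f8] at f6
    have f9 := (T ^ 2).finrank_range_add_finrank_ker
    rw [← hK₂] at f9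
    have hcard : Fintype.card (BlockIndex n) =
        n 0 + n 1 + n 2 + 2 * n 3 + 2 * n 4 + 2 * n 5 + 3 * n 6 := by
      rw [Fintype.card_sigma, Fin.sum_univ_seven]
      simp [blockChain]
    omega
  · rintro ⟨t, j, i⟩
    have hi := hmem t i
    fin_cases t
    · fin_cases j; exact hi
    · fin_cases j; exact hi.1
    · fin_cases j; trivial
    · fin_cases j
      · exact hi
      · exact h₁ hi
    · fin_cases j
      · trivial
      · exact hi
    · fin_cases j
      · trivial
      · exact h₂ ⟨_, rfl⟩
    · fin_cases j
      · trivial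
      · exact h₂ ⟨_, rfl⟩
      · exact h₁ (h₂ ⟨_, rfl⟩)
  · intro t i
    have hi := hmem t i
    fin_cases t
    · exact h₀ hi
    · exact hi.2
    · exact hi
    · exact h₀ (h₁ hi)
    · exact hCK₂ hi
    · exact hi
    · exact h₀ (h₁ (h₂ ⟨_, rfl⟩))
  · set S : Fin 4 → Submodule k V := fun l =>
      Submodule.span k (blockVector T u '' {x | (blockChain x.1).get x.2.1 ≤ l}) with hS
    have hSmono : Monotone S := fun l l' hl =>
      Submodule.span_mono (Set.image_mono fun x hx => le_trans hx hl)
    have hU : ∀ (t : Fin 7) (j : Fin (blockChain t).length),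
        (Submodule.span k (Set.range (u t))).map (T ^ (j : ℕ)) ≤ S ((blockChain t).get j) := by
      intro t j
      rw [Submodule.map_span, Submodule.span_le]
      rintro _ ⟨_, ⟨i, rfl⟩, rfl⟩
      exact Submodule.subset_span ⟨⟨t, j, i⟩, le_refl ((blockChain t).get j), rfl⟩
    set U : Fin 7 → Submodule k V := fun t => Submodule.span k (Set.range (u t)) with hUdef
    have hU0 : ∀ t (ht : 0 < (blockChain t).length), U t ≤ S ((blockChain t).get ⟨0, ht⟩) := by
      intro t ht
      have := hU t ⟨0, ht⟩
      rwa [pow_zero, Module.End.one_eq_id, Submodule.map_id] at this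
    have hU1 : ∀ t (ht : 1 < (blockChain t).length),
        (U t).map T ≤ S ((blockChain t).get ⟨1, ht⟩) := by
      intro t ht
      have := hU t ⟨1, ht⟩
      rwa [pow_one] at this
    have hU2 : ((U 6).map T).map T ≤ S 1 := by
      have := hU 6 ⟨2, by decide⟩
      rwa [sq, Module.End.mul_eq_comp, Submodule.map_comp] at this
    have q0 : M₁ = C.map T ⊔ U 0 := hu 0
    have q1 : M₂ ⊓ K = M₁ ⊔ K₂.map T ⊔ U 1 := hu 1
    have q2 : K = M₂ ⊓ K ⊔ U 2 := hu 2
    have q3 : M₂ = M₂ ⊓ K ⊔ LinearMap.range T ⊔ U 3 := hu 3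
    have q4 : C = M₂ ⊔ K ⊔ U 4 := hu 4
    have q5 : K₂ = C ⊔ U 5 := hu 5
    have q6 : ⊤ = K₂ ⊔ U 6 := hu 6
    have r0 : LinearMap.range T = K₂.map T ⊔ (U 6).map T := by
      rw [← Submodule.map_sup, ← q6, Submodule.map_top]
    -- The bootstrap starts here: `T` kills both M₂ ⊓ K and T K₂, so T M₂ reduces to T² U₆ and T U₃,
    -- which are tails of blocks. Then M₁, T K₂, M₂ ⊓ K, M₂, K and the whole space follow in turn.
    have r1 : M₂.map T ≤ S 1 := by
      rw [q3, Submodule.map_sup, Submodule.map_sup, r0, Submodule.map_sup]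
      have hk : (M₂ ⊓ K).map T ≤ S 1 := ((Submodule.map_mono inf_le_right).trans hTK.le).trans bot_le
      exact sup_le (sup_le hk (sup_le ((Submodule.map_mono hTK₂).trans hk) hU2))
        (hU1 3 (by decide))
    have r2 : M₁ ≤ S 1 := by
      rw [q0, q4, Submodule.map_sup, Submodule.map_sup, hTK]
      exact sup_le (sup_le (sup_le r1 bot_le) (hU1 4 (by decide))) (hU0 0 (by decide))
    have r3 : K₂.map T ≤ S 2 := by
      rw [q5, Submodule.map_sup]
      exact sup_le (hTC.trans (r2.trans (hSmono (by decide)))) (hU1 5 (by decide))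
    have r4 : M₂ ⊓ K ≤ S 2 := by
      rw [q1]
      exact sup_le (sup_le (r2.trans (hSmono (by decide))) r3) (hU0 1 (by decide))
    have r5 : M₂ ≤ S 2 := by
      rw [q3, r0]
      exact sup_le (sup_le r4 (sup_le r3 (hU1 6 (by decide)))) (hU0 3 (by decide))
    have r6 : K ≤ S 3 := by
      rw [q2]
      exact sup_le (r4.trans (hSmono (by decide))) (hU0 2 (by decide))
    have r7 : (⊤ : Submodule k V) ≤ S 3 := by
      rw [q6, q5, q4]
      exact sup_le (sup_le (sup_le (sup_le (r5.trans (hSmono (by decide))) r6)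
        (hU0 4 (by decide))) (hU0 5 (by decide))) (hU0 6 (by decide))
    intro l
    fin_cases l
    · exact bot_le
    · exact r2
    · exact r5
    · exact r7

end Decomposition

/-! ### Every PR module is a sum of blocks -/

section Classification

variable {k : Type u} [Field k] {h : ℕ} {d : Fin 3 → ℕ}

/-- Every module with PR datum is a direct sum of adapted Jordan blocks. -/
theorem PRModule.exists_iso_blockModule (M : PRModule k h d) :
    ∃ (n : Fin 7 → ℕ) (hgen : ∑ t, n t ≤ h)
      (hd : d = ![n 0 + n 3 + n 4 + n 6, n 1 + n 3 + n 5 + n 6, n 2 + n 4 + n 5 + n 6]),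
      M.Iso (blockModule k hgen hd) := by
  have := M.finite
  have hF : M.fil = ![⊥, M.fil 1, M.fil 2, ⊤] := by
    funext l
    fin_cases l
    · exact M.datum.fil_zero
    · rfl
    · rfl
    · exact M.datum.fil_last
  obtain ⟨n, u, hrank, hmem, hzero, hspan⟩ := exists_blockVector M.T (M₁ := M.fil 1)
    (M₂ := M.fil 2)
    (fun x hx => by
      have := M.datum.T_mem 0 x hx
      rw [Fin.castSucc_zero, M.datum.fil_zero] at this
      exact this)
    (M.datum.fil_mono (by decide)) (fun x hx => M.datum.T_mem 1 x hx)
    (by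
      rintro _ ⟨x, rfl⟩
      refine M.datum.T_mem 2 x ?_
      change x ∈ M.datum.fil (Fin.last 3)
      rw [M.datum.fil_last]
      trivial)
  rw [← hF] at hmem hspan
  let Φ : (BlockIndex n →₀ k) →ₗ[k] M.carrier :=
    Finsupp.linearCombination k (blockVector M.T u)
  have hΦ : ∀ x, Φ (Finsupp.single x 1) = blockVector M.T u x := fun x => by simp [Φ]
  have hmap : ∀ l, (blockFil k l).map Φ = M.fil l := by
    intro l
    have h1 : (blockFil k l).map Φ =
        Submodule.span k (blockVector M.T u '' {x | (blockChain x.1).get x.2.1 ≤ l}) := by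
      rw [blockFil, blockSpan, Finsupp.supported_eq_span_single, Submodule.map_span,
        Set.image_image]
      simp only [hΦ]
    refine le_antisymm ?_ (h1 ▸ hspan l)
    rw [h1, Submodule.span_le]
    rintro _ ⟨x, hx, rfl⟩
    exact M.datum.fil_mono hx (hmem x)
  have hsurj : Function.Surjective Φ := by
    intro y
    have hy : y ∈ M.fil (Fin.last 3) := M.datum.fil_last.symm.le Submodule.mem_top
    rw [← hmap] at hy
    obtain ⟨x, -, hx⟩ := hy
    exact ⟨x, hx⟩
  -- A surjection between spaces of equal dimension is injective; this is where the count of block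
  -- vectors is used.
  have hinj : Function.Injective Φ := by
    rwa [LinearMap.injective_iff_surjective_of_finrank_eq_finrank]
    rw [Module.finrank_finsupp_self, hrank]
  have hcomm : ∀ x, Φ (blockT k n x) = M.T (Φ x) := by
    intro x
    have : Φ ∘ₗ blockT k n = M.T ∘ₗ Φ := by
      refine Finsupp.lhom_ext' fun x => LinearMap.ext_ring ?_
      simp only [LinearMap.comp_apply, Finsupp.lsingle_apply]
      rw [hΦ, blockT_single]
      split_ifs with hx
      · rw [hΦ, blockVector, blockVector, pow_succ', Module.End.mul_apply]
      · have hlen : (x.2.1 : ℕ) + 1 = (blockChain x.1).length := by have := x.2.1.2; omega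
        rw [map_zero, blockVector, ← Module.End.mul_apply, ← pow_succ', hlen, hzero]
    exact LinearMap.congr_fun this x
  let g := LinearEquiv.ofBijective Φ ⟨hinj, hsurj⟩
  have hfil : ∀ l, Module.finrank k (M.fil l) = Module.finrank k (blockFil k (n := n) l) := by
    intro l
    rw [← hmap]
    exact (Submodule.equivMapOfInjective Φ hinj _).finrank_eq.symm
  have hrange : LinearMap.range M.T = (LinearMap.range (blockT k n)).map Φ := by
    rw [← LinearMap.range_comp, show Φ ∘ₗ blockT k n = M.T ∘ₗ Φ from LinearMap.ext hcomm,
      LinearMap.range_comp_of_range_eq_top _ (LinearMap.range_eq_top.2 hsurj)]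
  -- The number of blocks is dim M - rank T, bounded by the number of generators.
  have hgen : ∑ t, n t ≤ h := by
    have h1 := M.finrank_le
    have h2 := hfil (Fin.last 3)
    rw [hrange, ← (Submodule.equivMapOfInjective Φ hinj _).finrank_eq, finrank_range_blockT] at h1
    rw [finrank_blockFil, show M.fil (Fin.last 3) = ⊤ from M.datum.fil_last, finrank_top] at h2
    change _ = n 0 + n 1 + n 2 + 2 * n 3 + 2 * n 4 + 2 * n 5 + 3 * n 6 at h2
    rw [Fin.sum_univ_seven]
    omega
  have hd : d = ![n 0 + n 3 + n 4 + n 6, n 1 + n 3 + n 5 + n 6, n 2 + n 4 + n 5 + n 6] := by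
    funext i
    have h1 := M.finrank_fil_succ i
    rw [hfil, hfil, finrank_blockFil, finrank_blockFil] at h1
    fin_cases i <;> simp at h1 ⊢ <;> omega
  refine ⟨n, hgen, hd, (PRModule.isoSetoid k h d).symm ?_⟩
  refine PRModule.Iso.of_linearEquiv (M := blockModule k hgen hd) g ?_ ?_
  · intro x
    rw [blockModule_T]
    exact hcomm x
  · intro l x
    rw [← hmap, blockModule_fil]
    exact (hinj.mem_set_image).symm

end Classification

/-! ### Hodge triples and admissibility -/

section HodgeTriple

variable {k : Type u} [Field k] {h : ℕ}

theorem PRModule.finrank_range_subT {e : ℕ} {d : Fin e → ℕ} (M : PRModule k h d)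
    (i : Fin (e + 1)) : Module.finrank k (LinearMap.range (M.subT i)) =
      Module.finrank k ((M.fil i).map M.T) := by
  have h1 : (LinearMap.range (M.subT i)).map (M.fil i).subtype = (M.fil i).map M.T := by
    rw [← LinearMap.range_comp, ← LinearMap.range_domRestrict]
    rfl
  rw [← h1, Submodule.finrank_map_subtype_eq]

/-- The image of `T` on the quotient is (T M + M_i) / M_i. -/
theorem PRModule.finrank_range_quotT_add {e : ℕ} {d : Fin e → ℕ} (M : PRModule k h d)
    (i : Fin (e + 1)) : Module.finrank k (LinearMap.range (M.quotT i)) +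
      Module.finrank k (M.fil i) =
        Module.finrank k (LinearMap.range M.T ⊔ M.fil i : Submodule k M.carrier) := by
  have := M.finite
  have h1 : LinearMap.range (M.quotT i) =
      (LinearMap.range M.T ⊔ M.fil i).map (M.fil i).mkQ := by
    rw [Submodule.map_sup, (LinearMap.le_ker_iff_map (f := (M.fil i).mkQ)).1
      (M.fil i).ker_mkQ.ge, sup_bot_eq, ← LinearMap.range_comp, PRModule.quotT,
      ← Submodule.mapQ_mkQ, LinearMap.range_comp_of_range_eq_top _ (M.fil i).range_mkQ]
  have h2 := ((M.fil i).mkQ.domRestrict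
    (LinearMap.range M.T ⊔ M.fil i)).finrank_range_add_finrank_ker
  rw [LinearMap.range_domRestrict, ← h1, LinearMap.ker_domRestrict, Submodule.ker_mkQ] at h2
  rw [← h2]
  congr 1
  exact (Submodule.submoduleOfEquivOfLe le_sup_right).finrank_eq.symm

theorem hodgePolygon_two_eq {V : Type u} [AddCommGroup V] [Module k V] [Module.Finite k V]
    {T : Module.End k V} (hT : T ^ 2 = 0) {a b : ℕ} (ha : a ≤ h)
    (h0 : Module.finrank k V = a + b) (h1 : Module.finrank k (LinearMap.range T) = b) :
    hodgePolygon h 2 T = polygonOf h ![a, b] := by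
  refine hodgePolygon_eq_polygonOf hT (by omega) fun j => ?_
  fin_cases j
  · change Module.finrank k (LinearMap.range (T ^ 0)) =
      Module.finrank k (LinearMap.range (T ^ 1)) + a
    rw [pow_zero, pow_one, Module.End.one_eq_id, LinearMap.range_id, finrank_top, h0, h1, add_comm]
  · change Module.finrank k (LinearMap.range (T ^ 1)) =
      Module.finrank k (LinearMap.range (T ^ 2)) + b
    rw [hT, pow_one, LinearMap.range_zero, finrank_bot, h1, zero_add]

theorem hodgePolygon_three_eq {V : Type u} [AddCommGroup V] [Module k V] [Module.Finite k V]
    {T : Module.End k V} (hT : T ^ 3 = 0) {a b c : ℕ} (ha : a ≤ h)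
    (h0 : Module.finrank k V = a + b + c) (h1 : Module.finrank k (LinearMap.range T) = b + c)
    (h2 : Module.finrank k (LinearMap.range (T ^ 2)) = c) :
    hodgePolygon h 3 T = polygonOf h ![a, b, c] := by
  refine hodgePolygon_eq_polygonOf hT (by omega) fun j => ?_
  fin_cases j
  · change Module.finrank k (LinearMap.range (T ^ 0)) =
      Module.finrank k (LinearMap.range (T ^ 1)) + a
    rw [pow_zero, pow_one, Module.End.one_eq_id, LinearMap.range_id, finrank_top, h0, h1]
    ring
  · change Module.finrank k (LinearMap.range (T ^ 1)) =
      Module.finrank k (LinearMap.range (T ^ 2)) + b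
    rw [pow_one, h1, h2, add_comm]
  · change Module.finrank k (LinearMap.range (T ^ 2)) =
      Module.finrank k (LinearMap.range (T ^ 3)) + c
    rw [hT, LinearMap.range_zero, finrank_bot, h2, zero_add]

variable {d : Fin 3 → ℕ}

theorem PRModule.subT_two_sq (M : PRModule k h d) : M.subT 2 ^ 2 = 0 := by
  refine LinearMap.ext fun x => Subtype.ext ?_
  have h1 := M.datum.T_mem 0 _ (M.datum.T_mem 1 x x.2)
  rw [Fin.castSucc_zero, M.datum.fil_zero] at h1
  rw [sq]
  exact h1

theorem PRModule.quotT_one_sq (M : PRModule k h d) : M.quotT 1 ^ 2 = 0 := by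
  refine LinearMap.ext fun y => ?_
  obtain ⟨x, rfl⟩ := Submodule.mkQ_surjective _ y
  have hx : x ∈ M.datum.fil (Fin.last 3) := M.datum.fil_last.symm.le Submodule.mem_top
  rw [sq]
  exact (Submodule.Quotient.mk_eq_zero _).2 (M.datum.T_mem 1 _ (M.datum.T_mem 2 x hx))

/-- Entry j of each polygon counts the blocks of length at least j: the full blocks for `M`, the
blocks without their 3 for `M₂`, and without their 1 for `M / M₁`. -/
theorem hodgeTriple_blockModule {n : Fin 7 → ℕ} (hgen : ∑ t, n t ≤ h)
    (hd : d = ![n 0 + n 3 + n 4 + n 6, n 1 + n 3 + n 5 + n 6, n 2 + n 4 + n 5 + n 6]) :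
    hodgeTriple (blockModule k hgen hd) =
      (polygonOf h ![n 0 + n 1 + n 2 + n 3 + n 4 + n 5 + n 6, n 3 + n 4 + n 5 + n 6, n 6],
        polygonOf h ![n 0 + n 1 + n 3 + n 4 + n 5 + n 6, n 3 + n 6],
        polygonOf h ![n 1 + n 2 + n 3 + n 4 + n 5 + n 6, n 5 + n 6]) := by
  have hfin := (blockModule k hgen hd).finite
  have hgen' := hgen
  rw [Fin.sum_univ_seven] at hgen'
  have htop : Module.finrank k (blockModule k hgen hd).carrier =
      n 0 + n 1 + n 2 + 2 * n 3 + 2 * n 4 + 2 * n 5 + 3 * n 6 := by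
    have h1 := finrank_blockFil k (n := n) 3
    have h2 : blockFil k (n := n) 3 = ⊤ := (blockModule k hgen hd).datum.fil_last
    rw [h2, finrank_top] at h1
    exact h1
  have hfil1 : Module.finrank k ((blockModule k hgen hd).fil 1) = n 0 + n 3 + n 4 + n 6 :=
    finrank_blockFil k (n := n) 1
  have hfil2 : Module.finrank k ((blockModule k hgen hd).fil 2) =
      n 0 + n 1 + 2 * n 3 + n 4 + n 5 + 2 * n 6 := finrank_blockFil k (n := n) 2
  have hsub : Module.finrank k (LinearMap.range ((blockModule k hgen hd).subT 2)) = n 3 + n 6 := by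
    rw [PRModule.finrank_range_subT, blockModule_T]
    exact finrank_map_blockT_blockFil_two k
  have hquot : Module.finrank k (LinearMap.range ((blockModule k hgen hd).quotT 1)) +
      Module.finrank k ((blockModule k hgen hd).fil 1) = n 0 + n 3 + n 4 + n 5 + 2 * n 6 := by
    rw [PRModule.finrank_range_quotT_add, blockModule_T]
    exact finrank_range_blockT_sup_blockFil_one k
  have hq := Submodule.finrank_quotient_add_finrank ((blockModule k hgen hd).fil 1)
  refine Prod.ext ?_ (Prod.ext ?_ ?_)
  · refine hodgePolygon_three_eq ?_ (by omega) (by omega) ?_ ?_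
    · rw [blockModule_T]; exact blockT_pow_three k
    · rw [blockModule_T]
      exact (finrank_range_blockT k).trans (by ring)
    · rw [blockModule_T]; exact finrank_range_blockT_sq k
  · exact hodgePolygon_two_eq (PRModule.subT_two_sq _) (by omega) (by omega) hsub
  · exact hodgePolygon_two_eq (PRModule.quotT_one_sq _) (by omega) (by omega) (by omega)

theorem hodgeTriple_mem_yAdm {n : Fin 7 → ℕ} {d₁ d₂ d₃ : ℕ} (h₂ : d₂ ≤ d₁) (h₃ : d₃ ≤ d₂)
    (hgen : ∑ t, n t ≤ h) (e₁ : d₁ = n 0 + n 3 + n 4 + n 6) (e₂ : d₂ = n 1 + n 3 + n 5 + n 6)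
    (e₃ : d₃ = n 2 + n 4 + n 5 + n 6) :
    (polygonOf h ![n 0 + n 1 + n 2 + n 3 + n 4 + n 5 + n 6, n 3 + n 4 + n 5 + n 6, n 6],
        polygonOf h ![n 0 + n 1 + n 3 + n 4 + n 5 + n 6, n 3 + n 6],
        polygonOf h ![n 1 + n 2 + n 3 + n 4 + n 5 + n 6, n 5 + n 6]) ∈ yAdm h d₁ d₂ d₃ := by
  rw [Fin.sum_univ_seven] at hgen
  refine ⟨⟨⟨?_, ?_, ?_⟩, ⟨?_, ?_, ?_⟩, ⟨?_, ?_⟩, ?_, ?_⟩, _, _, _, _, _, _, _,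
    ⟨?_, ?_, ?_, rfl⟩, ⟨?_, ?_, rfl⟩, ⟨?_, ?_, rfl⟩, ?_⟩
  · refine polygonOf_mem_polygonSet fun i => ?_
    fin_cases i <;> simp <;> omega
  · refine polygonOf_mem_polygonSet fun i => ?_
    fin_cases i <;> simp <;> omega
  · refine polygonOf_mem_polygonSet fun i => ?_
    fin_cases i <;> simp <;> omega
  · rw [polygonOf_right, e₁, e₂, e₃]
    simp [Fin.sum_univ_succ]
    ring
  · rw [polygonOf_right, e₁, e₂]
    simp [Fin.sum_univ_succ]
    ring
  · rw [polygonOf_right, e₂, e₃]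
    simp [Fin.sum_univ_succ]
    ring
  · change HPolygon.star 2 1 (polygonOf h ![_, _]) _ ≤ polygonOf h ![_, _, _]
    rw [star_polygonOf]
    apply polygonOf_triple_le <;> omega
  · change HPolygon.star 2 1 (polygonOf h ![_, _]) _ ≤ polygonOf h ![_, _, _]
    rw [star_polygonOf]
    apply polygonOf_triple_le <;> omega
  · apply polygonOf_pair_le <;> omega
  · apply polygonOf_pair_le <;> omega
  all_goals omega

/-- The admissible triples are those given by nonnegative multiplicities of blocks. -/
theorem exists_multiplicities_of_mem_yAdm {d₁ d₂ d₃ : ℕ} {P : HPolygon h × HPolygon h × HPolygon h}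
    (hP : P ∈ yAdm h d₁ d₂ d₃) : ∃ n : Fin 7 → ℕ, ∑ t, n t ≤ h ∧
      ![d₁, d₂, d₃] = ![n 0 + n 3 + n 4 + n 6, n 1 + n 3 + n 5 + n 6, n 2 + n 4 + n 5 + n 6] ∧
      P = (polygonOf h ![n 0 + n 1 + n 2 + n 3 + n 4 + n 5 + n 6, n 3 + n 4 + n 5 + n 6, n 6],
        polygonOf h ![n 0 + n 1 + n 3 + n 4 + n 5 + n 6, n 3 + n 6],
        polygonOf h ![n 1 + n 2 + n 3 + n 4 + n 5 + n 6, n 5 + n 6]) := by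
  obtain ⟨⟨-, ⟨hr1, hr2, hr3⟩, ⟨hs1, hs2⟩, ht1, ht2⟩, δ₁, δ₂, δ₃, α₁, α₂, β₁, β₂,
    ⟨hδ, hδ', hδh, eδ⟩, ⟨hα, hαh, eα⟩, ⟨hβ, hβh, eβ⟩, hadm⟩ := hP
  obtain ⟨P₁, P₂, P₃⟩ := P
  dsimp only at *
  subst eδ eα eβ
  have s1 := sum_eq_of_polygonOf_right_eq (s := d₁ + d₂ + d₃) three_ne_zero
    (hr1.trans (by push_cast; ring))
  have s2 := sum_eq_of_polygonOf_right_eq (s := d₁ + d₂) two_ne_zero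
    (hr2.trans (by push_cast; ring))
  have s3 := sum_eq_of_polygonOf_right_eq (s := d₂ + d₃) two_ne_zero
    (hr3.trans (by push_cast; ring))
  rw [star_polygonOf] at hs1 hs2
  simp only [Fin.sum_univ_two, Fin.sum_univ_three, Matrix.cons_val_zero, Matrix.cons_val_one,
    Matrix.cons_val] at s1 s2 s3
  have hmax : ∀ i, ![δ₁, δ₂, δ₃] i ≤ δ₁ := by
    intro i
    fin_cases i <;> simp <;> omega
  have hmin : ∀ i, δ₃ ≤ ![δ₁, δ₂, δ₃] i := by
    intro i
    fin_cases i <;> simp <;> omega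
  -- Only extreme entries are needed from the two `⋆`-inequalities: α₁, β₁ ≤ δ₁ from index 0, then
  -- δ₃ ≤ α₂, β₂ from index 1.
  have u1 := le_of_polygonOf_le three_ne_zero hs1 hδh hmax 0
  have u2 := le_of_polygonOf_le three_ne_zero hs2 hδh hmax 0
  have v1 := ge_of_polygonOf_le three_ne_zero hs1
    (by simp [Fin.sum_univ_three]; omega) (by omega) hmin 1
  have v2 := ge_of_polygonOf_le three_ne_zero hs2
    (by simp [Fin.sum_univ_three]; omega) (by omega) hmin 1
  simp only [Matrix.cons_val_zero, Matrix.cons_val_one] at u1 u2 v1 v2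
  have m1 := le_max_left d₂ δ₂
  have m2 := le_max_right d₂ δ₂
  -- The solution of the linear system: n 6 = δ₃, then n 3 and n 5 from α₂ and β₂, n 4 from δ₂, and
  -- n 0, n 1, n 2 from d. The inequalities above ensure that no subtraction truncates.
  refine ⟨![d₁ + β₂ - δ₂ - δ₃, d₂ + δ₃ - α₂ - β₂, d₃ + α₂ - δ₂ - δ₃, α₂ - δ₃, δ₂ + δ₃ - α₂ - β₂,
    β₂ - δ₃, δ₃], ?_, ?_, ?_⟩
  · rw [Fin.sum_univ_seven]
    simp only [Matrix.cons_val]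
    omega
  · simp only [Matrix.cons_val]
    congr! <;> omega
  · simp only [Matrix.cons_val]
    congr! <;> omega

end HodgeTriple

end

/-! ### The bijection -/

theorem mainTheorem3 {k : Type u} [Field k] (h d₁ d₂ d₃ : ℕ) (hh : 1 ≤ h)
    (h₁ : d₁ ≤ h) (h₂ : d₂ ≤ d₁) (h₃ : d₃ ≤ d₂) :
    Set.BijOn (phi k h ![d₁, d₂, d₃]) Set.univ (yAdm h d₁ d₂ d₃) := by
  refine ⟨?_, ?_, ?_⟩
  · intro x _
    obtain ⟨M, rfl⟩ := Quotient.exists_rep x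
    obtain ⟨n, hgen, hd, hiso⟩ := M.exists_iso_blockModule
    change hodgeTriple M ∈ _
    rw [hodgeTriple_congr _ _ hiso, hodgeTriple_blockModule]
    exact hodgeTriple_mem_yAdm h₂ h₃ hgen (congrFun hd 0) (congrFun hd 1) (congrFun hd 2)
  · intro x _ y _ hxy
    obtain ⟨M, rfl⟩ := Quotient.exists_rep x
    obtain ⟨N, rfl⟩ := Quotient.exists_rep y
    change hodgeTriple M = hodgeTriple N at hxy
    obtain ⟨n, hgen, hd, hiso⟩ := M.exists_iso_blockModule
    obtain ⟨n', hgen', hd', hiso'⟩ := N.exists_iso_blockModule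
    rw [hodgeTriple_congr _ _ hiso, hodgeTriple_congr _ _ hiso', hodgeTriple_blockModule,
      hodgeTriple_blockModule, Prod.mk.injEq, Prod.mk.injEq] at hxy
    obtain ⟨hp1, hp2, hp3⟩ := hxy
    have e := hd.symm.trans hd'
    have e0 : n 0 + n 3 + n 4 + n 6 = n' 0 + n' 3 + n' 4 + n' 6 := congrFun e 0
    have e1 : n 1 + n 3 + n 5 + n 6 = n' 1 + n' 3 + n' 5 + n' 6 := congrFun e 1
    have e2 : n 2 + n 4 + n 5 + n 6 = n' 2 + n' 4 + n' 5 + n' 6 := congrFun e 2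
    have g := hgen
    have g' := hgen'
    rw [Fin.sum_univ_seven] at g g'
    have q1 := polygonOf_triple_injective (by omega) (by omega) (by omega) (by omega) (by omega)
      (by omega) (by omega) hp1
    have q2 := polygonOf_pair_injective (by omega) (by omega) (by omega) (by omega) (by omega) hp2
    have q3 := polygonOf_pair_injective (by omega) (by omega) (by omega) (by omega) (by omega) hp3
    -- The entries of the three polygons together with `d` determine all seven multiplicities.
    have hn : n = n' := by
      funext t
      fin_cases t <;> simp only [Fin.zero_eta, Fin.mk_one, Fin.reduceFinMk] <;> omega
    subst hn
    exact Quotient.sound ((PRModule.isoSetoid k h _).trans hiso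
      ((PRModule.isoSetoid k h _).symm hiso'))
  · intro P hP
    obtain ⟨n, hgen, hd, rfl⟩ := exists_multiplicities_of_mem_yAdm hP
    exact ⟨Quotient.mk _ (blockModule k hgen hd), trivial, hodgeTriple_blockModule hgen hd⟩
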